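/- Let $\mathcal H,\mathcal K$ be finite dimensional complex Hilbert spaces and let $\sigma$ be a state on $B(\mathcal H)$ (a positive operator with $\mathrm{Tr}\,\sigma=1$). Notation. For a positive operator $A$ and $z\in\mathbb C$, $A^z$ denotes $(A|_{\mathrm{supp}(A)})^z\oplus 0$. For a positive operator $\tau$, $L_\tau$ is the space of operators whose support and range lie in $\mathrm{supp}(\tau)$. For $1\le p\le\infty$ with $1/p+1/q=1$ and $Y\in L_\tau$, put $\|Y\|_{p,\tau}=\|\tau^{-1/2q}\,Y\,\tau^{-1/2q}\|_p$, where $\|X\|_p=(\mathrm{Tr}\,|X|^p)^{1/p}$ for $p<\infty$ and $\|X\|_\infty=\|X\|$ is the operator norm. Let $S=\{z\in\mathbb C: 0\le \mathrm{Re}\,z\le 1\}$. For $Y\in L_\sigma$ and $1<p<\infty$ let $X=\sigma^{-1/2q}Y\sigma^{-1/2q}$, with polar decomposition $X=U|X|$, and $$f_{Y,p}(z)=\|Y\|_{p,\sigma}^{1-zp}\,\sigma^{(1-z)/2}\,U|X|^{zp}\,\sigma^{(1-z)/2},\qquad z\in S.$$ (a) Let $h:S\to L_\sigma$ be bounded and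 continuous, and holomorphic in the interior of $S$. Put $M=\max\{\sup_{t\in\mathbb R}\|h(it)\|_{\infty,\sigma},\ \sup_{t\in\mathbb R}\|h(1+it)\|_1\}$. Then $\|h(\theta)\|_{1/\theta,\sigma}\le M$ for every $\theta\in[0,1]$ (with $1/0=\infty$). If equality holds for some $\theta\in(0,1)$, then it holds for all $\theta\in[0,1]$. (b) Let $\Phi:B(\mathcal H)\to B(\mathcal K)$ be a positive trace-preserving linear map, let $1<p<\infty$, and let $Y\in L_\sigma$ be such that $\|\Phi(Y)\|_{p,\Phi(\sigma)}=\|Y\|_{p,\sigma}$. Then $$\|\Phi(f_{Y,p}(\theta))\|_{1/\theta,\Phi(\sigma)}=\|f_{Y,p}(\theta)\|_{1/\theta,\sigma}\qquad\text{for all }\theta\in(0,1).$$ -/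

import Mathlib

open scoped ENNReal

noncomputable section

namespace StateLp

variable {H : Type*} [NormedAddCommGroup H] [InnerProductSpace ℂ H] [CompleteSpace H]

/-- The trace of an operator. -/
def opTrace (X : H →L[ℂ] H) : ℂ := LinearMap.trace ℂ H (X : H →ₗ[ℂ] H)

/-- States: positive operators with unit trace. -/
def IsState (σ : H →L[ℂ] H) : Prop := σ.IsPositive ∧ opTrace σ = 1

/-- The power `A ^ z` of a positive operator `A`, `z` complex, formed on the support of `A` and
extended by zero: `(A restricted to supp A) ^ z ⊕ 0`. In particular `suppPow A 0` is the projection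
onto the support of `A`. -/
def suppPow (A : H →L[ℂ] H) (z : ℂ) : H →L[ℂ] H :=
  cfc (fun w : ℂ => if w = 0 then 0 else w ^ z) A

/-- The Schatten norm: `(Tr |X| ^ p) ^ (1 / p)` for finite `p`, the operator norm for `p = ∞`.
It is used for `1 ≤ p ≤ ∞`. -/
def schattenNorm (p : ℝ≥0∞) (X : H →L[ℂ] H) : ℝ :=
  if p = ∞ then ‖X‖
  else (opTrace (suppPow (CFC.abs X) (p.toReal : ℂ))).re ^ (1 / p.toReal)

/-- The support of an operator: the orthogonal complement of its kernel. -/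
def supp (X : H →L[ℂ] H) : Submodule ℂ H := (LinearMap.ker (X : H →ₗ[ℂ] H))ᗮ

/-- The space `L_σ(H)` of operators whose support and range lie in the support of `σ`. -/
def LSpace (σ : H →L[ℂ] H) : Set (H →L[ℂ] H) :=
  {Y | supp Y ≤ supp σ ∧ LinearMap.range (Y : H →ₗ[ℂ] H) ≤ supp σ}

/-- The number `1 / (2 q)`, where `1 / p + 1 / q = 1`. -/
def halfDualInv (p : ℝ≥0∞) : ℝ := (1 - (p⁻¹).toReal) / 2

/-- The operator `σ ^ (-1 / (2 q)) * Y * σ ^ (-1 / (2 q))`, where `1 / p + 1 / q = 1`. -/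
def weighted (p : ℝ≥0∞) (σ Y : H →L[ℂ] H) : H →L[ℂ] H :=
  suppPow σ (-(halfDualInv p : ℂ)) * Y * suppPow σ (-(halfDualInv p : ℂ))

/-- The norm `‖Y‖_{p,σ}` of `Y ∈ L_σ(H)`, `1 ≤ p ≤ ∞`. -/
def lpNorm (p : ℝ≥0∞) (σ Y : H →L[ℂ] H) : ℝ := schattenNorm p (weighted p σ Y)

/-- The partial isometry `U` in the polar decomposition `X = U * |X|`. -/
def polarPart (X : H →L[ℂ] H) : H →L[ℂ] H := X * suppPow (CFC.abs X) (-1)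

/-- The family `f_{Y,p}(z) = ‖Y‖_{p,σ} ^ (1 - z p) • σ ^ ((1 - z) / 2) U |X| ^ (z p) σ ^ ((1 - z) / 2)`,
where `X = U |X|` is the polar decomposition of `X = σ ^ (-1 / (2 q)) Y σ ^ (-1 / (2 q))`. -/
def interpFamily (σ Y : H →L[ℂ] H) (p : ℝ) (z : ℂ) : H →L[ℂ] H :=
  let X := weighted (ENNReal.ofReal p) σ Y
  ((lpNorm (ENNReal.ofReal p) σ Y : ℂ) ^ (1 - z * p)) •
    (suppPow σ ((1 - z) / 2) * polarPart X * suppPow (CFC.abs X) (z * p) *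
      suppPow σ ((1 - z) / 2))

/-- The closed strip `0 ≤ Re z ≤ 1`. -/
def strip : Set ℂ := {z | 0 ≤ z.re ∧ z.re ≤ 1}

/-- The quantity `max {sup_t ‖h(it)‖_{∞,σ}, sup_t ‖h(1+it)‖_1}`. -/
def boundaryMax (σ : H →L[ℂ] H) (h : ℂ → H →L[ℂ] H) : ℝ :=
  max (⨆ t : ℝ, lpNorm ∞ σ (h (Complex.I * t))) (⨆ t : ℝ, schattenNorm 1 (h (1 + Complex.I * t)))

/-- Positive maps. -/
def IsPositiveMap {K : Type*} [NormedAddCommGroup K] [InnerProductSpace ℂ K] [CompleteSpace K]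
    (Φ : (H →L[ℂ] H) →ₗ[ℂ] (K →L[ℂ] K)) : Prop :=
  ∀ X : H →L[ℂ] H, X.IsPositive → (Φ X).IsPositive

/-- Trace-preserving maps. -/
def IsTracePreserving {K : Type*} [NormedAddCommGroup K] [InnerProductSpace ℂ K] [CompleteSpace K]
    (Φ : (H →L[ℂ] H) →ₗ[ℂ] (K →L[ℂ] K)) : Prop :=
  ∀ X : H →L[ℂ] H, opTrace (Φ X) = opTrace X

theorem contSpec [FiniteDimensional ℂ H] (f : ℂ → ℂ) (A : H →L[ℂ] H) : ContinuousOn f (spectrum ℂ A) := by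
  apply Set.Finite.continuousOn
  rw [ContinuousLinearMap.spectrum_eq]
  exact Module.End.finite_spectrum _

theorem suppPow_mul [FiniteDimensional ℂ H] (A : H →L[ℂ] H) (z w : ℂ) :
    suppPow A z * suppPow A w = suppPow A (z + w) := by
  unfold suppPow
  rw [← cfc_mul _ _ A (contSpec _ A) (contSpec _ A)]
  congr 1; ext x
  split_ifs with h <;> simp [Complex.cpow_add, h]

theorem suppPow_one {A : H →L[ℂ] H} (hA : IsStarNormal A) : suppPow A 1 = A := by
  unfold suppPow
  conv_rhs => rw [← cfc_id ℂ A]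
  congr 1; ext x
  by_cases h : x = 0 <;> simp [h]

open scoped ComplexOrder in
theorem suppPow_star {A : H →L[ℂ] H} (hA : 0 ≤ A) (t : ℝ) : star (suppPow A t) = suppPow A t := by
  unfold suppPow
  rw [← cfc_star]
  apply cfc_congr
  intro x hx
  have h0 : 0 ≤ x := spectrum_nonneg_of_nonneg hA hx
  obtain ⟨r, rfl⟩ : ∃ r : ℝ, x = r := ⟨x.re, by
    rw [Complex.le_def] at h0
    apply Complex.ext <;> simp [← h0.2]⟩
  have hr : 0 ≤ r := by exact_mod_cast h0
  by_cases h : r = 0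
  · simp [h]
  · simp only [Complex.ofReal_eq_zero, h, if_false]
    rw [← Complex.ofReal_cpow hr]; simp

/-- The operator `polarPart X` is a partial isometry with initial space the support of `|X|`. -/
theorem polar_initial [FiniteDimensional ℂ H] (X : H →L[ℂ] H) :
    star (polarPart X) * polarPart X = suppPow (CFC.abs X) 0 := by
  have hs := suppPow_star (CFC.abs_nonneg X) (-1)
  have hn : IsStarNormal (CFC.abs X) := (IsSelfAdjoint.of_nonneg (CFC.abs_nonneg X)).isStarNormal
  push_cast at hs
  have h1 : star (polarPart X) * polarPart X = suppPow (CFC.abs X) (-1) * (CFC.abs X * CFC.abs X) * suppPow (CFC.abs X) (-1) := by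
    rw [CFC.abs_mul_abs, polarPart, star_mul, hs]; simp only [mul_assoc]
  rw [h1]
  nth_rw 2 3 [← suppPow_one hn]
  simp only [suppPow_mul]
  norm_num

theorem mul_supp [FiniteDimensional ℂ H] (X : H →L[ℂ] H) : X * suppPow (CFC.abs X) 0 = X := by
  have hs := suppPow_star (CFC.abs_nonneg X) 0
  have hn : IsStarNormal (CFC.abs X) := (IsSelfAdjoint.of_nonneg (CFC.abs_nonneg X)).isStarNormal
  push_cast at hs
  have h2 : CFC.abs X * suppPow (CFC.abs X) 0 = CFC.abs X := by
    have h3 := suppPow_mul (CFC.abs X) 1 0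
    rwa [add_zero, suppPow_one hn] at h3
  have : star (X * suppPow (CFC.abs X) 0 - X) * (X * suppPow (CFC.abs X) 0 - X) = 0 := by
    have e : star (X * suppPow (CFC.abs X) 0 - X) * (X * suppPow (CFC.abs X) 0 - X) =
      star (suppPow (CFC.abs X) 0 - 1) * (star X * X) * (suppPow (CFC.abs X) 0 - 1) := by
      simp only [star_sub, star_mul, star_one]; noncomm_ring
    rw [e, ← CFC.abs_mul_abs]
    have : CFC.abs X * (suppPow (CFC.abs X) 0 - 1) = 0 := by rw [mul_sub, h2]; simp
    rw [mul_assoc, mul_assoc, this]; simp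
  rw [CStarRing.star_mul_self_eq_zero_iff] at this
  exact sub_eq_zero.mp this

/-- The polar decomposition `X = U * |X|`. -/
theorem polar_mul_abs [FiniteDimensional ℂ H] (X : H →L[ℂ] H) : polarPart X * CFC.abs X = X := by
  have hn : IsStarNormal (CFC.abs X) := (IsSelfAdjoint.of_nonneg (CFC.abs_nonneg X)).isStarNormal
  have h3 := suppPow_mul (CFC.abs X) (-1) 1
  rw [neg_add_cancel, suppPow_one hn] at h3
  rw [polarPart, mul_assoc, h3, mul_supp]

end StateLp

end

open StateLp

noncomputable section

set_option linter.unusedSectionVars false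

namespace StateLp

open scoped ComplexOrder

variable {H : Type*} [NormedAddCommGroup H] [InnerProductSpace ℂ H] [CompleteSpace H]
variable [FiniteDimensional ℂ H]

/-! ### The trace -/

/-! Part (a) is a duality argument. Fix θ in (0,1), let X = σ^(-(1-θ)/2) h(θ) σ^(-(1-θ)/2) = U|X|, r
= 1/θ and c = 1/Tr |X|^r. The Schatten norm of X is its trace pairing with c^(1-θ) |X|^(r(1-θ)) U*.
Replacing θ by z everywhere gives a holomorphic function φ (`pairing`). Imaginary powers of positive
operators are contractions, so |φ| is bounded by the two boundary norms of h, hence by M on the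
strip. Hölder's inequality, itself a three lines argument, gives |φ(η)| ≤ ‖h(η)‖_{1/η,σ} for every
real η. If the norm at θ equals M, then |φ(θ)| = M, the maximum modulus principle makes |φ|
constant, and every norm on the segment is M.

For (b), Φ maps L_σ into L_{Φ(σ)} and contracts both endpoint norms. Both contractions come from the
Russo–Dye theorem: for the trace norm it is applied to the unital adjoint of Φ, and for the weighted
operator norm to X ↦ Φ(σ)^(-1/2) Φ(σ^(1/2) X σ^(1/2)) Φ(σ)^(-1/2). The family f_{Y,p} has boundary
norms at most ‖Y‖_{p,σ} and passes through Y at z = 1/p. Thus f_{Y,p}, and by hypothesis also Φ ∘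
f_{Y,p}, attains equality in (a) at 1/p, and both have constant norm ‖Y‖_{p,σ}. -/

theorem opTrace_eq_sum {ι : Type*} [Fintype ι] (b : OrthonormalBasis ι ℂ H) (X : H →L[ℂ] H) :
    opTrace X = ∑ i, inner ℂ (b i) (X (b i)) :=
  LinearMap.trace_eq_sum_inner _ b

theorem opTrace_mul_comm (A B : H →L[ℂ] H) : opTrace (A * B) = opTrace (B * A) :=
  LinearMap.trace_mul_comm ℂ (A : H →ₗ[ℂ] H) B

/-- The trace as a continuous linear functional. -/
def opTraceCLM : (H →L[ℂ] H) →L[ℂ] ℂ :=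
  LinearMap.toContinuousLinearMap
    ((LinearMap.trace ℂ H).comp (ContinuousLinearMap.coeLM (R := ℂ) (M := H) (N₃ := H) ℂ))

theorem opTraceCLM_apply (X : H →L[ℂ] H) : opTraceCLM X = opTrace X := rfl

theorem opTrace_add (A B : H →L[ℂ] H) : opTrace (A + B) = opTrace A + opTrace B :=
  map_add opTraceCLM A B

theorem opTrace_smul (c : ℂ) (A : H →L[ℂ] H) : opTrace (c • A) = c * opTrace A :=
  map_smul opTraceCLM c A

theorem opTrace_nonneg {P : H →L[ℂ] H} (hP : 0 ≤ P) : 0 ≤ (opTrace P).re := by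
  rw [opTrace_eq_sum (stdOrthonormalBasis ℂ H), Complex.re_sum]
  refine Finset.sum_nonneg fun i _ => ?_
  exact ((ContinuousLinearMap.nonneg_iff_isPositive P).1 hP).re_inner_nonneg_right _

theorem exists_self_adjoint_sqrt {P : H →L[ℂ] H} (hP : 0 ≤ P) :
    ∃ Q : H →L[ℂ] H, star Q = Q ∧ Q * Q = P :=
  ⟨CFC.sqrt P, (IsSelfAdjoint.of_nonneg (CFC.sqrt_nonneg P)).star_eq, CFC.sqrt_mul_sqrt_self P⟩

theorem inner_star_apply (A : H →L[ℂ] H) (x y : H) : inner ℂ (star A x) y = inner ℂ x (A y) := by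
  rw [ContinuousLinearMap.star_eq_adjoint, ContinuousLinearMap.adjoint_inner_left]

theorem opTrace_im {P : H →L[ℂ] H} (hP : 0 ≤ P) : (opTrace P).im = 0 := by
  obtain ⟨Q, hQ, rfl⟩ := exists_self_adjoint_sqrt hP
  rw [opTrace_eq_sum (stdOrthonormalBasis ℂ H), Complex.im_sum]
  refine Finset.sum_eq_zero fun i _ => ?_
  rw [mul_apply_eq_comp, ← inner_star_apply, hQ]
  exact inner_self_im (𝕜 := ℂ) _

theorem opTrace_eq_ofReal {P : H →L[ℂ] H} (hP : 0 ≤ P) : opTrace P = ((opTrace P).re : ℂ) :=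
  Complex.ext (by simp) (by simp [opTrace_im hP])

/-- With P = Q², cyclicity turns the trace into ∑ ⟨Q e_i, A Q e_i⟩, and Cauchy–Schwarz applies to
each term. -/
theorem norm_opTrace_mul_le (A : H →L[ℂ] H) {P : H →L[ℂ] H} (hP : 0 ≤ P) :
    ‖opTrace (A * P)‖ ≤ ‖A‖ * (opTrace P).re := by
  obtain ⟨Q, hQ, rfl⟩ := exists_self_adjoint_sqrt hP
  set b := stdOrthonormalBasis ℂ H
  rw [← mul_assoc, opTrace_mul_comm, opTrace_eq_sum b, opTrace_eq_sum b, Complex.re_sum,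
    Finset.mul_sum]
  refine (norm_sum_le _ _).trans (Finset.sum_le_sum fun i _ => ?_)
  rw [mul_apply_eq_comp, mul_apply_eq_comp, mul_apply_eq_comp, ← inner_star_apply Q,
    ← inner_star_apply Q, hQ]
  have h1 : (inner ℂ (Q (b i)) (Q (b i))).re = ‖Q (b i)‖ * ‖Q (b i)‖ := by
    rw [← sq]; exact inner_self_eq_norm_sq (𝕜 := ℂ) _
  rw [h1]
  calc _ ≤ ‖Q (b i)‖ * ‖A (Q (b i))‖ := norm_inner_le_norm _ _
    _ ≤ ‖Q (b i)‖ * (‖A‖ * ‖Q (b i)‖) := by gcongr; exact A.le_opNorm _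
    _ = _ := by ring

theorem opTrace_mul_rankOne (A : H →L[ℂ] H) (x y : H) :
    opTrace (A * InnerProductSpace.rankOne ℂ x y) = inner ℂ y (A x) := by
  rw [ContinuousLinearMap.mul_def, InnerProductSpace.comp_rankOne]
  exact InnerProductSpace.trace_rankOne _ _

/-- Pairing P with the rank-one operator built from x and P x gives ‖P x‖². -/
theorem eq_zero_of_opTrace_eq_zero {P : H →L[ℂ] H} (hP : 0 ≤ P) (h : (opTrace P).re = 0) :
    P = 0 := by
  ext x
  have h1 := norm_opTrace_mul_le (InnerProductSpace.rankOne ℂ x (P x)) hP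
  rw [h, mul_zero, norm_le_zero_iff, opTrace_mul_comm, opTrace_mul_rankOne,
    inner_self_eq_zero] at h1
  simpa using h1

/-! ### Spectral decomposition and complex powers -/

/-- The spectral projections of a normal operator. -/
def specProj (A : H →L[ℂ] H) (w : ℂ) : H →L[ℂ] H := cfc (fun x : ℂ => if x = w then 1 else 0) A

/-- The spectrum as a finite set. -/
def specFinset (A : H →L[ℂ] H) : Finset ℂ :=
  Set.Finite.toFinset (s := spectrum ℂ A) (by
    rw [ContinuousLinearMap.spectrum_eq]; exact Module.End.finite_spectrum _)

theorem mem_specFinset {A : H →L[ℂ] H} {w : ℂ} : w ∈ specFinset A ↔ w ∈ spectrum ℂ A :=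
  Set.Finite.mem_toFinset _

theorem cfc_eq_sum_specProj (f : ℂ → ℂ) {A : H →L[ℂ] H} :
    cfc f A = ∑ w ∈ specFinset A, f w • specProj A w := by
  have h : cfc f A = cfc (∑ w ∈ specFinset A, fun x : ℂ => f w * (if x = w then 1 else 0)) A := by
    refine cfc_congr fun x hx => ?_
    simp [Finset.sum_apply, mem_specFinset.2 hx]
  rw [h, cfc_sum _ _ _ (fun i _ => contSpec _ A)]
  refine Finset.sum_congr rfl fun w _ => ?_
  rw [specProj, ← cfc_const_mul _ _ _ (contSpec _ A)]

theorem specProj_nonneg (A : H →L[ℂ] H) (w : ℂ) : 0 ≤ specProj A w := by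
  refine cfc_nonneg fun x _ => ?_
  split_ifs <;> simp

/-- The spectrum is finite, so the power is a finite sum of scalar exponentials w ^ z times fixed
projections. -/
theorem differentiable_suppPow (A : H →L[ℂ] H) : Differentiable ℂ (suppPow A) := by
  have h : suppPow A = fun z => ∑ w ∈ specFinset A, (if w = 0 then 0 else w ^ z) • specProj A w := by
    funext z; exact cfc_eq_sum_specProj _
  rw [h]
  refine Differentiable.fun_sum fun w _ => ?_
  by_cases hw : w = 0
  · simp [hw]
  · simp only [hw, if_false]
    refine Differentiable.smul_const (fun z => ?_) _
    exact differentiableAt_id.const_cpow (Or.inl hw)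

theorem exists_nonneg_real {A : H →L[ℂ] H} (hA : 0 ≤ A) {x : ℂ} (hx : x ∈ spectrum ℂ A) :
    ∃ r : ℝ, 0 ≤ r ∧ x = r := by
  have h0 : 0 ≤ x := spectrum_nonneg_of_nonneg hA hx
  rw [Complex.le_def] at h0
  exact ⟨x.re, h0.1, Complex.ext rfl (by simpa using h0.2.symm)⟩

/-- Positive eigenvalues are sent to the unit circle and 0 to 0. Every boundary estimate uses this
to discard factors with imaginary exponent. -/
theorem norm_suppPow_I_le {A : H →L[ℂ] H} (hA : 0 ≤ A) {z : ℂ} (hz : z.re = 0) :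
    ‖suppPow A z‖ ≤ 1 := by
  refine norm_cfc_le zero_le_one fun x hx => ?_
  obtain ⟨r, hr, rfl⟩ := exists_nonneg_real hA hx
  split_ifs with h
  · simp
  · have hr' : 0 < r := lt_of_le_of_ne hr (fun h' => h (by simp [← h']))
    rw [Complex.norm_cpow_eq_rpow_re_of_pos hr', hz, Real.rpow_zero]

theorem suppPow_nonneg {A : H →L[ℂ] H} (hA : 0 ≤ A) (t : ℝ) : 0 ≤ suppPow A t := by
  have h : suppPow A t = star (suppPow A ((t / 2 : ℝ) : ℂ)) * suppPow A ((t / 2 : ℝ) : ℂ) := by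
    rw [suppPow_star hA, suppPow_mul]; push_cast; ring_nf
  rw [h]; exact star_mul_self_nonneg _

/-- A family `z ↦ A ^ (a z + b)` is bounded on the strip. -/
theorem exists_norm_suppPow_le {A : H →L[ℂ] H} (hA : 0 ≤ A) (a b : ℝ) :
    ∃ C : ℝ, ∀ z ∈ strip, ‖suppPow A (a * z + b)‖ ≤ C := by
  have hc : Continuous fun t : ℝ => ‖suppPow A ((a * t + b : ℝ) : ℂ)‖ := by
    have := (differentiable_suppPow A).continuous
    fun_prop
  obtain ⟨C, hC⟩ := (isCompact_Icc (a := (0 : ℝ)) (b := 1)).exists_bound_of_continuousOn hc.continuousOn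
  refine ⟨C, fun z hz => ?_⟩
  -- The real part of the exponent ranges over a compact interval; the imaginary part contributes a
  -- contraction.
  have h : suppPow A (a * z + b)
      = suppPow A ((a * z.re + b : ℝ) : ℂ) * suppPow A (a * z.im * Complex.I) := by
    rw [suppPow_mul]; congr 1
    conv_lhs => rw [← Complex.re_add_im z]
    push_cast; ring
  rw [h]
  have h1 := hC z.re hz
  rw [norm_norm] at h1
  calc _ ≤ ‖suppPow A ((a * z.re + b : ℝ) : ℂ)‖ * ‖suppPow A (a * z.im * Complex.I)‖ := norm_mul_le _ _
    _ ≤ ‖suppPow A ((a * z.re + b : ℝ) : ℂ)‖ * 1 := by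
      gcongr; exact norm_suppPow_I_le hA (by simp)
    _ ≤ C := by rwa [mul_one]

/-! ### The polar decomposition and the trace norm -/

theorem suppPow_zero_mul_abs (X : H →L[ℂ] H) : suppPow (CFC.abs X) 0 * CFC.abs X = CFC.abs X := by
  have hn : IsStarNormal (CFC.abs X) := (IsSelfAdjoint.of_nonneg (CFC.abs_nonneg X)).isStarNormal
  have h := suppPow_mul (CFC.abs X) 0 1
  rwa [zero_add, suppPow_one hn] at h

theorem star_polarPart_mul (X : H →L[ℂ] H) : star (polarPart X) * X = CFC.abs X := by
  conv_lhs => rw [← polar_mul_abs X]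
  -- The rewrite also expanded the `X` inside `polarPart`; this folds it back.
  have h : polarPart (polarPart X * CFC.abs X) = polarPart X := by rw [polar_mul_abs]
  rw [h, ← mul_assoc, polar_initial, suppPow_zero_mul_abs]

theorem norm_polarPart_le (X : H →L[ℂ] H) : ‖polarPart X‖ ≤ 1 := by
  have h := norm_suppPow_I_le (CFC.abs_nonneg X) (z := 0) rfl
  rw [← polar_initial, CStarRing.norm_star_mul_self] at h
  nlinarith [norm_nonneg (polarPart X)]

theorem norm_mul_le_one {A B : H →L[ℂ] H} (hA : ‖A‖ ≤ 1) (hB : ‖B‖ ≤ 1) : ‖A * B‖ ≤ 1 :=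
  (norm_mul_le A B).trans (mul_le_one₀ hA (norm_nonneg _) hB)

theorem schattenNorm_one (X : H →L[ℂ] H) : schattenNorm 1 X = (opTrace (CFC.abs X)).re := by
  have hn : IsStarNormal (CFC.abs X) := (IsSelfAdjoint.of_nonneg (CFC.abs_nonneg X)).isStarNormal
  simp [schattenNorm, suppPow_one hn]

theorem schattenNorm_nonneg (p : ℝ≥0∞) (X : H →L[ℂ] H) : 0 ≤ schattenNorm p X := by
  unfold schattenNorm
  split_ifs
  · exact norm_nonneg _
  · exact Real.rpow_nonneg (opTrace_nonneg (suppPow_nonneg (CFC.abs_nonneg X) _)) _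

theorem norm_opTrace_mul_le_schattenNorm_one (A X : H →L[ℂ] H) :
    ‖opTrace (A * X)‖ ≤ ‖A‖ * schattenNorm 1 X := by
  rw [schattenNorm_one]
  have h : A * X = A * polarPart X * CFC.abs X := by rw [mul_assoc, polar_mul_abs]
  rw [h]
  refine (norm_opTrace_mul_le _ (CFC.abs_nonneg X)).trans ?_
  gcongr
  · exact opTrace_nonneg (CFC.abs_nonneg X)
  · exact (norm_mul_le _ _).trans (mul_le_of_le_one_right (norm_nonneg _) (norm_polarPart_le X))

/-- The single choice W = U* from X = U|X| gives Tr |X|. -/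
theorem schattenNorm_one_le {X : H →L[ℂ] H} {c : ℝ}
    (h : ∀ W : H →L[ℂ] H, ‖W‖ ≤ 1 → ‖opTrace (W * X)‖ ≤ c) : schattenNorm 1 X ≤ c := by
  rw [schattenNorm_one, ← star_polarPart_mul]
  exact (Complex.re_le_norm _).trans (h _ (by rw [norm_star]; exact norm_polarPart_le X))

theorem schattenNorm_one_mul_mul_le {A X B : H →L[ℂ] H} (hA : ‖A‖ ≤ 1) (hB : ‖B‖ ≤ 1) :
    schattenNorm 1 (A * X * B) ≤ schattenNorm 1 X := by
  refine schattenNorm_one_le fun W hW => ?_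
  have h : opTrace (W * (A * X * B)) = opTrace (B * (W * A) * X) := by
    rw [mul_assoc B, opTrace_mul_comm B]; simp only [mul_assoc]
  rw [h]
  refine (norm_opTrace_mul_le_schattenNorm_one _ _).trans ?_
  exact mul_le_of_le_one_left (schattenNorm_nonneg _ _)
    (norm_mul_le_one hB (norm_mul_le_one hW hA))

theorem schattenNorm_one_le_norm (X : H →L[ℂ] H) :
    schattenNorm 1 X ≤ ‖X‖ * (opTrace (1 : H →L[ℂ] H)).re := by
  refine schattenNorm_one_le fun W hW => ?_
  have h := norm_opTrace_mul_le (W * X) (zero_le_one (α := H →L[ℂ] H))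
  rw [mul_one] at h
  refine h.trans ?_
  gcongr
  · exact opTrace_nonneg zero_le_one
  · exact (norm_mul_le _ _).trans (mul_le_of_le_one_left (norm_nonneg _) hW)

theorem schattenNorm_one_of_nonneg {P : H →L[ℂ] H} (hP : 0 ≤ P) :
    schattenNorm 1 P = (opTrace P).re := by
  rw [schattenNorm_one, CFC.abs_of_nonneg P hP]

theorem schattenNorm_one_smul (c : ℂ) (X : H →L[ℂ] H) :
    schattenNorm 1 (c • X) = ‖c‖ * schattenNorm 1 X := by
  rw [schattenNorm_one, schattenNorm_one, CFC.abs_smul]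
  change (opTrace (((‖c‖ : ℝ) : ℂ) • CFC.abs X)).re = _
  rw [opTrace_smul, Complex.re_ofReal_mul]

/-! ### Functions on the strip -/

theorem interior_strip : interior strip = Complex.HadamardThreeLines.verticalStrip 0 1 := by
  have : strip = Complex.re ⁻¹' Set.Icc 0 1 := rfl
  rw [this, Complex.interior_preimage_re, interior_Icc]; rfl

theorem closure_interior_strip : closure (interior strip) = strip := by
  rw [interior_strip]
  change closure (Complex.re ⁻¹' Set.Ioo 0 1) = _
  rw [Complex.closure_preimage_re, closure_Ioo (by norm_num)]; rfl

theorem ofReal_mem_strip {θ : ℝ} (hθ : θ ∈ Set.Icc (0 : ℝ) 1) : (θ : ℂ) ∈ strip := hθ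

/-- Bounded continuous functions on the strip that are holomorphic inside. -/
def IsStripFun {E : Type*} [NormedAddCommGroup E] [NormedSpace ℂ E] (f : ℂ → E) : Prop :=
  (∃ C : ℝ, ∀ z ∈ strip, ‖f z‖ ≤ C) ∧ ContinuousOn f strip ∧ DifferentiableOn ℂ f (interior strip)

theorem IsStripFun.diffContOnCl {E : Type*} [NormedAddCommGroup E] [NormedSpace ℂ E] {f : ℂ → E}
    (hf : IsStripFun f) : DiffContOnCl ℂ f (interior strip) :=
  ⟨hf.2.2, by rw [closure_interior_strip]; exact hf.2.1⟩

theorem IsStripFun.mul {f g : ℂ → H →L[ℂ] H} (hf : IsStripFun f) (hg : IsStripFun g) :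
    IsStripFun (fun z => f z * g z) := by
  obtain ⟨⟨C, hC⟩, hfc, hfd⟩ := hf
  obtain ⟨⟨D, hD⟩, hgc, hgd⟩ := hg
  refine ⟨⟨C * D, fun z hz => (norm_mul_le _ _).trans ?_⟩, hfc.mul hgc, hfd.mul hgd⟩
  exact mul_le_mul (hC z hz) (hD z hz) (norm_nonneg _) ((norm_nonneg _).trans (hC z hz))

theorem IsStripFun.smul {c : ℂ → ℂ} {g : ℂ → H →L[ℂ] H} (hf : IsStripFun c) (hg : IsStripFun g) :
    IsStripFun (fun z => c z • g z) := by
  obtain ⟨⟨C, hC⟩, hfc, hfd⟩ := hf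
  obtain ⟨⟨D, hD⟩, hgc, hgd⟩ := hg
  refine ⟨⟨C * D, fun z hz => (norm_smul_le _ _).trans ?_⟩, hfc.smul hgc, hfd.smul hgd⟩
  exact mul_le_mul (hC z hz) (hD z hz) (norm_nonneg _) ((norm_nonneg _).trans (hC z hz))

theorem isStripFun_const {E : Type*} [NormedAddCommGroup E] [NormedSpace ℂ E] (e : E) :
    IsStripFun (fun _ => e) :=
  ⟨⟨‖e‖, fun _ _ => le_rfl⟩, continuousOn_const, differentiableOn_const _⟩

theorem IsStripFun.clm {E F : Type*} [NormedAddCommGroup E] [NormedSpace ℂ E]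
    [NormedAddCommGroup F] [NormedSpace ℂ F] {f : ℂ → E} (hf : IsStripFun f) (L : E →L[ℂ] F) :
    IsStripFun (fun z => L (f z)) := by
  obtain ⟨⟨C, hC⟩, hfc, hfd⟩ := hf
  refine ⟨⟨‖L‖ * C, fun z hz => (L.le_opNorm _).trans ?_⟩, ?_, ?_⟩
  · gcongr; exact hC z hz
  · exact L.continuous.comp_continuousOn hfc
  · exact L.differentiable.comp_differentiableOn hfd

theorem isStripFun_suppPow {A : H →L[ℂ] H} (hA : 0 ≤ A) (a b : ℝ) :
    IsStripFun (fun z => suppPow A (a * z + b)) := by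
  have h : Differentiable ℂ (fun z : ℂ => suppPow A (a * z + b)) :=
    (differentiable_suppPow A).comp (by fun_prop)
  exact ⟨exists_norm_suppPow_le hA a b, h.continuous.continuousOn, h.differentiableOn⟩

theorem isStripFun_cpow {c : ℝ} (hc : 0 < c) (a b : ℝ) :
    IsStripFun (fun z => (c : ℂ) ^ (a * z + b)) := by
  have h : Differentiable ℂ (fun z : ℂ => (c : ℂ) ^ (a * z + b)) := fun z =>
    DifferentiableAt.const_cpow (by fun_prop) (Or.inl (by exact_mod_cast hc.ne'))
  refine ⟨?_, h.continuous.continuousOn, h.differentiableOn⟩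
  have hc' : Continuous fun t : ℝ => c ^ (a * t + b) := by
    have := hc.ne'
    exact Continuous.rpow (by fun_prop) (by fun_prop) (fun _ => Or.inl this)
  obtain ⟨C, hC⟩ := (isCompact_Icc (a := (0 : ℝ)) (b := 1)).exists_bound_of_continuousOn
    hc'.continuousOn
  refine ⟨C, fun z hz => ?_⟩
  rw [Complex.norm_cpow_eq_rpow_re_of_pos hc]
  refine (le_abs_self _).trans ?_
  simpa using hC z.re hz

theorem IsStripFun.norm_le_interp {f : ℂ → ℂ} (hf : IsStripFun f) {a b : ℝ}
    (ha : ∀ t : ℝ, ‖f (Complex.I * t)‖ ≤ a) (hb : ∀ t : ℝ, ‖f (1 + Complex.I * t)‖ ≤ b)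
    {z : ℂ} (hz : z ∈ strip) : ‖f z‖ ≤ a ^ (1 - z.re) * b ^ z.re := by
  obtain ⟨C, hC⟩ := hf.1
  have h := Complex.HadamardThreeLines.norm_le_interp_of_mem_verticalClosedStrip' (f := f) (z := z)
    (a := a) (b := b) zero_lt_one hz (by rw [← interior_strip]; exact hf.diffContOnCl)
    ⟨C, by rintro _ ⟨w, hw, rfl⟩; exact hC w hw⟩ ?_ ?_
  · simpa using h
  · intro w hw
    have e : w = Complex.I * w.im := by
      apply Complex.ext <;> simp; exact hw
    rw [e]; exact ha _
  · intro w hw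
    have e : w = 1 + Complex.I * w.im := by
      apply Complex.ext <;> simp; exact hw
    rw [e]; exact hb _

theorem IsStripFun.norm_le {f : ℂ → ℂ} (hf : IsStripFun f) {M : ℝ}
    (ha : ∀ t : ℝ, ‖f (Complex.I * t)‖ ≤ M) (hb : ∀ t : ℝ, ‖f (1 + Complex.I * t)‖ ≤ M)
    {z : ℂ} (hz : z ∈ strip) : ‖f z‖ ≤ M := by
  have hM : 0 ≤ M := (norm_nonneg _).trans (ha 0)
  refine (hf.norm_le_interp ha hb hz).trans ?_
  -- For M = 0 exponents do not add, but one of 1 - x and x is nonzero, so the product still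
  -- vanishes.
  rcases hM.eq_or_lt with rfl | hM
  · rcases eq_or_ne z.re 0 with h | h
    · simp [h]
    · simp [Real.zero_rpow h]
  · rw [← Real.rpow_add hM]; simp

theorem IsStripFun.norm_eq {f : ℂ → ℂ} (hf : IsStripFun f) {M : ℝ}
    (hM : ∀ z ∈ strip, ‖f z‖ ≤ M) {w : ℂ} (hw : w ∈ interior strip) (hfw : ‖f w‖ = M)
    {z : ℂ} (hz : z ∈ strip) : ‖f z‖ = M := by
  have hconv : Convex ℝ (interior strip) := by
    rw [interior_strip]
    exact (convex_Ioo (0 : ℝ) 1).linear_preimage Complex.reLm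
  have h := Complex.norm_eqOn_closure_of_isPreconnected_of_isMaxOn hconv.isPreconnected
    isOpen_interior hf.diffContOnCl hw (fun y hy => by
      simp only [Function.comp, Set.mem_ofPred_eq, hfw]; exact hM y (interior_subset hy))
  rw [closure_interior_strip] at h
  simpa [hfw] using h hz

/-! ### Schatten norms and Hölder's inequality -/

theorem schattenNorm_inv_ofReal {θ : ℝ} (hθ : 0 < θ) (X : H →L[ℂ] H) :
    schattenNorm (ENNReal.ofReal θ)⁻¹ X
      = (opTrace (suppPow (CFC.abs X) ((θ⁻¹ : ℝ) : ℂ))).re ^ θ := by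
  have h : (ENNReal.ofReal θ)⁻¹ ≠ ∞ := by simpa using hθ
  rw [schattenNorm, if_neg h, ENNReal.toReal_inv, ENNReal.toReal_ofReal hθ.le, one_div, inv_inv]

theorem norm_opTrace_mul_suppPow_le {P : H →L[ℂ] H} (hP : 0 ≤ P) (r s : ℝ) (A : H →L[ℂ] H) :
    ‖opTrace (A * suppPow P (r + Complex.I * s))‖ ≤ ‖A‖ * (opTrace (suppPow P r)).re := by
  rw [add_comm, ← suppPow_mul, ← mul_assoc]
  refine (norm_opTrace_mul_le _ (suppPow_nonneg hP r)).trans ?_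
  gcongr
  · exact opTrace_nonneg (suppPow_nonneg hP r)
  · exact (norm_mul_le _ _).trans
      (mul_le_of_le_one_right (norm_nonneg _) (norm_suppPow_I_le hP (by simp)))

/-- Hölder's inequality for the trace of powers of positive operators. -/
theorem norm_opTrace_suppPow_mul_suppPow_le {P T V W : H →L[ℂ] H} (hP : 0 ≤ P) (hT : 0 ≤ T)
    (hV : ‖V‖ ≤ 1) (hW : ‖W‖ ≤ 1) (r s : ℝ) {θ : ℝ} (hθ : θ ∈ Set.Icc (0 : ℝ) 1) :
    ‖opTrace (V * suppPow P (r * θ) * suppPow T (s * (1 - θ)) * W)‖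
      ≤ (opTrace (suppPow T s)).re ^ (1 - θ) * (opTrace (suppPow P r)).re ^ θ := by
  -- Hölder by three lines, with θ replaced by z: on Re z = 0 the power of P is a contraction and
  -- T^s remains, on Re z = 1 the roles are exchanged.
  have hf : IsStripFun fun z : ℂ =>
      opTraceCLM (V * suppPow P (r * z + (0 : ℝ)) * suppPow T ((-s : ℝ) * z + s) * W) :=
    ((((isStripFun_const V).mul (isStripFun_suppPow hP r 0)).mul
      (isStripFun_suppPow hT (-s) s)).mul (isStripFun_const W)).clm _
  have h := hf.norm_le_interp (a := (opTrace (suppPow T s)).re) (b := (opTrace (suppPow P r)).re)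
    (fun t => ?_) (fun t => ?_) (ofReal_mem_strip hθ)
  · have e : ((-s : ℝ) : ℂ) * θ + s = s * (1 - θ) := by push_cast; ring
    rw [e] at h
    simpa [opTraceCLM_apply] using h
  · have e : ((-s : ℝ) : ℂ) * (Complex.I * t) + s = s + Complex.I * ((-s * t : ℝ) : ℂ) := by
      push_cast; ring
    simp only [opTraceCLM_apply]
    rw [opTrace_mul_comm, e, ← mul_assoc]
    refine (norm_opTrace_mul_suppPow_le hT _ _ _).trans ?_
    refine mul_le_of_le_one_left (opTrace_nonneg (suppPow_nonneg hT s)) ?_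
    exact norm_mul_le_one hW (norm_mul_le_one hV (norm_suppPow_I_le hP (by simp)))
  · have e : (r : ℂ) * (1 + Complex.I * t) + (0 : ℝ) = r + Complex.I * ((r * t : ℝ) : ℂ) := by
      push_cast; ring
    simp only [opTraceCLM_apply]
    rw [mul_assoc, opTrace_mul_comm, e, ← mul_assoc]
    refine (norm_opTrace_mul_suppPow_le hP _ _ _).trans ?_
    refine mul_le_of_le_one_left (opTrace_nonneg (suppPow_nonneg hP r)) ?_
    exact norm_mul_le_one (norm_mul_le_one (norm_suppPow_I_le hT (by simp)) hW) hV

/-- Hölder's inequality against the operators `(c P ^ r) ^ (1 - θ) W` with `Tr (c P ^ r) = 1`. -/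
theorem norm_opTrace_mul_le_schattenNorm {P W : H →L[ℂ] H} (hP : 0 ≤ P) (hW : ‖W‖ ≤ 1) {r c : ℝ}
    (hc : 0 < c) (hcP : c * (opTrace (suppPow P r)).re = 1) {θ : ℝ} (hθ : θ ∈ Set.Icc (0 : ℝ) 1)
    (A : H →L[ℂ] H) :
    ‖opTrace (A * (((c : ℂ) ^ (1 - θ : ℂ)) • (suppPow P (r * (1 - θ)) * W)))‖
      ≤ schattenNorm (ENNReal.ofReal θ)⁻¹ A := by
  have hn : ‖(c : ℂ) ^ (1 - θ : ℂ)‖ = c ^ (1 - θ) := by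
    rw [Complex.norm_cpow_eq_rpow_re_of_pos hc]; simp
  rw [mul_smul_comm, opTrace_smul, norm_mul, hn, ← mul_assoc]
  -- At θ = 0 the exponent (ofReal 0)⁻¹ is ∞, so the norm is the operator norm. For θ > 0, writing A
  -- = U |A|^(θ⁻¹ θ) puts the trace in Hölder form.
  rcases hθ.1.eq_or_lt with rfl | hθ0
  · have h := norm_opTrace_mul_suppPow_le hP r 0 (W * A)
    have e : opTrace (A * suppPow P (r * (1 - (0 : ℝ))) * W)
        = opTrace (W * A * suppPow P (r + Complex.I * (0 : ℝ))) := by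
      rw [opTrace_mul_comm, mul_assoc]; simp
    rw [e]
    simp only [schattenNorm, ENNReal.ofReal_zero, ENNReal.inv_zero, if_true, sub_zero,
      Real.rpow_one]
    have hWA : ‖W * A‖ ≤ ‖A‖ :=
      (norm_mul_le _ _).trans (mul_le_of_le_one_left (norm_nonneg _) hW)
    calc _ ≤ c * (‖W * A‖ * (opTrace (suppPow P r)).re) := by gcongr
      _ = ‖W * A‖ * (c * (opTrace (suppPow P r)).re) := by ring
      _ ≤ ‖A‖ := by rw [hcP, mul_one]; exact hWA
  · have hA : A * suppPow P (r * (1 - θ)) * W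
        = polarPart A * suppPow (CFC.abs A) ((θ⁻¹ : ℝ) * θ) * suppPow P (r * (1 - θ)) * W := by
      have hn : IsStarNormal (CFC.abs A) :=
        (IsSelfAdjoint.of_nonneg (CFC.abs_nonneg A)).isStarNormal
      have e : ((θ⁻¹ : ℝ) : ℂ) * θ = 1 := by
        rw [← Complex.ofReal_mul, inv_mul_cancel₀ hθ0.ne']; simp
      rw [e, suppPow_one hn, polar_mul_abs]
    have h := norm_opTrace_suppPow_mul_suppPow_le (CFC.abs_nonneg A) hP (norm_polarPart_le A) hW
      θ⁻¹ r hθ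
    rw [schattenNorm_inv_ofReal hθ0, hA]
    calc _ ≤ c ^ (1 - θ) * ((opTrace (suppPow P r)).re ^ (1 - θ)
          * (opTrace (suppPow (CFC.abs A) ((θ⁻¹ : ℝ) : ℂ))).re ^ θ) := by gcongr
      _ = (c * (opTrace (suppPow P r)).re) ^ (1 - θ)
          * (opTrace (suppPow (CFC.abs A) ((θ⁻¹ : ℝ) : ℂ))).re ^ θ := by
        rw [Real.mul_rpow hc.le (opTrace_nonneg (suppPow_nonneg hP r)), mul_assoc]
      _ = _ := by rw [hcP, Real.one_rpow, one_mul]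

/-- The Schatten norm is attained in the duality. -/
theorem opTrace_mul_dual {θ : ℝ} (hθ : 0 < θ) {X : H →L[ℂ] H}
    (hX : 0 < (opTrace (suppPow (CFC.abs X) ((θ⁻¹ : ℝ) : ℂ))).re) :
    opTrace (X * ((((opTrace (suppPow (CFC.abs X) ((θ⁻¹ : ℝ) : ℂ))).re⁻¹ : ℝ) : ℂ) ^ (1 - θ : ℂ) •
      (suppPow (CFC.abs X) ((θ⁻¹ : ℝ) * (1 - θ)) * star (polarPart X))))
      = schattenNorm (ENNReal.ofReal θ)⁻¹ X := by
  have hn : IsStarNormal (CFC.abs X) := (IsSelfAdjoint.of_nonneg (CFC.abs_nonneg X)).isStarNormal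
  rw [schattenNorm_inv_ofReal hθ, mul_smul_comm, opTrace_smul]
  -- U*X = |X| raises the exponent 1/θ - 1 to 1/θ; the scalar τ^(-(1-θ)) then turns τ = Tr |X|^(1/θ)
  -- into τ^θ.
  have e : opTrace (X * (suppPow (CFC.abs X) ((θ⁻¹ : ℝ) * (1 - θ)) * star (polarPart X)))
      = opTrace (suppPow (CFC.abs X) ((θ⁻¹ : ℝ) : ℂ)) := by
    rw [← mul_assoc, opTrace_mul_comm, ← mul_assoc, star_polarPart_mul]
    have h := suppPow_mul (CFC.abs X) 1 ((θ⁻¹ : ℝ) * (1 - θ))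
    rw [suppPow_one hn] at h
    have e1 : (1 : ℂ) + (θ⁻¹ : ℝ) * (1 - θ) = (θ⁻¹ : ℝ) := by
      have : (θ : ℂ) ≠ 0 := by exact_mod_cast hθ.ne'
      push_cast; field_simp; ring
    rw [h, e1]
  rw [e]
  set τ := (opTrace (suppPow (CFC.abs X) ((θ⁻¹ : ℝ) : ℂ))).re with hτ
  rw [opTrace_eq_ofReal (suppPow_nonneg (CFC.abs_nonneg X) _), ← hτ]
  have e2 : (1 - θ : ℂ) = ((1 - θ : ℝ) : ℂ) := by push_cast; rfl
  rw [e2, ← Complex.ofReal_cpow (inv_nonneg.2 hX.le), ← Complex.ofReal_mul]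
  congr 1
  rw [Real.inv_rpow hX.le, Real.rpow_sub hX, Real.rpow_one]
  field_simp

/-- Vanishing trace kills |X|^(1/θ); multiplying by the inverse power gives |X|^0 = 0, and X = X
|X|^0. -/
theorem eq_zero_of_schattenNorm_eq_zero {θ : ℝ} (hθ : 0 < θ) {X : H →L[ℂ] H}
    (h : schattenNorm (ENNReal.ofReal θ)⁻¹ X = 0) : X = 0 := by
  have h0 := suppPow_nonneg (CFC.abs_nonneg X) θ⁻¹
  rw [schattenNorm_inv_ofReal hθ, Real.rpow_eq_zero (opTrace_nonneg h0) hθ.ne'] at h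
  have h1 := eq_zero_of_opTrace_eq_zero h0 h
  have h2 := suppPow_mul (CFC.abs X) ((θ⁻¹ : ℝ) : ℂ) (-((θ⁻¹ : ℝ) : ℂ))
  rw [h1, zero_mul, add_neg_cancel] at h2
  rw [← mul_supp X, ← h2, mul_zero]

/-! ### The weighted spaces -/

/-- With p = 1/θ the exponent 1/(2q) is (1-θ)/2, affine in θ, so the weight extends to an analytic
family; θ = 0 covers p = ∞. -/
theorem weighted_inv_ofReal {θ : ℝ} (hθ : 0 ≤ θ) (σ Y : H →L[ℂ] H) :
    weighted (ENNReal.ofReal θ)⁻¹ σ Y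
      = suppPow σ (-((1 - θ) / 2)) * Y * suppPow σ (-((1 - θ) / 2)) := by
  simp [weighted, halfDualInv, ENNReal.toReal_ofReal hθ]

theorem suppPow_mul_apply_of_ker {σ : H →L[ℂ] H} (hσ : 0 ≤ σ) (z : ℂ) {x : H} (hx : σ x = 0) :
    suppPow σ z x = 0 := by
  have h := suppPow_mul σ (z - 1) 1
  rw [suppPow_one (IsSelfAdjoint.of_nonneg hσ).isStarNormal, sub_add_cancel] at h
  rw [← h, mul_apply_eq_comp, hx, map_zero]

/-- `suppPow σ 0` takes values in supp σ and fixes it pointwise. The support condition is used in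
its dual form, ker σ ≤ ker Y. -/
theorem mem_LSpace_iff {σ : H →L[ℂ] H} (hσ : 0 ≤ σ) {Y : H →L[ℂ] H} :
    Y ∈ LSpace σ ↔ suppPow σ 0 * Y = Y ∧ Y * suppPow σ 0 = Y := by
  have hn : IsStarNormal σ := (IsSelfAdjoint.of_nonneg hσ).isStarNormal
  have hE : star (suppPow σ 0) = suppPow σ 0 := by simpa using suppPow_star hσ 0
  have hσE : ∀ x, σ (suppPow σ 0 x) = σ x := fun x => by
    have h := suppPow_mul σ 1 0
    rw [add_zero, suppPow_one hn] at h
    exact DFunLike.congr_fun h x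
  have hEsupp : ∀ x, suppPow σ 0 x ∈ supp σ := fun x => by
    intro k hk
    rw [← hE, ← inner_conj_symm, inner_star_apply, suppPow_mul_apply_of_ker hσ 0 hk]
    simp
  have hEfix : ∀ x ∈ supp σ, suppPow σ 0 x = x := fun x hx => by
    have h1 : suppPow σ 0 x - x ∈ LinearMap.ker (σ : H →ₗ[ℂ] H) := by
      simp [hσE]
    have h2 : suppPow σ 0 x - x ∈ (LinearMap.ker (σ : H →ₗ[ℂ] H))ᗮ :=
      Submodule.sub_mem _ (hEsupp x) hx
    exact sub_eq_zero.1 (inner_self_eq_zero.1 (h2 _ h1))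
  have hsub : ∀ x, x - suppPow σ 0 x ∈ LinearMap.ker (σ : H →ₗ[ℂ] H) := fun x => by
    simp [hσE]
  constructor
  · rintro ⟨h1, h2⟩
    constructor
    · ext x
      exact hEfix _ (h2 ⟨x, rfl⟩)
    · have h3 := Submodule.orthogonal_le h1
      rw [supp, supp, Submodule.orthogonal_orthogonal, Submodule.orthogonal_orthogonal] at h3
      ext x
      have h4 : Y (x - suppPow σ 0 x) = 0 := h3 (hsub x)
      rw [map_sub, sub_eq_zero] at h4
      exact h4.symm
  · rintro ⟨h1, h2⟩
    constructor
    · refine Submodule.orthogonal_le fun x hx => ?_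
      change Y x = 0
      rw [← h2, mul_apply_eq_comp, suppPow_mul_apply_of_ker hσ 0 hx, map_zero]
    · rintro _ ⟨x, rfl⟩
      rw [← h1]
      exact hEsupp _

/-! ### Interpolation on the strip -/

theorem lpNorm_nonneg (p : ℝ≥0∞) (σ Y : H →L[ℂ] H) : 0 ≤ lpNorm p σ Y := schattenNorm_nonneg _ _

theorem lpNorm_top (σ Y : H →L[ℂ] H) :
    lpNorm ∞ σ Y = ‖suppPow σ (-(1 / 2)) * Y * suppPow σ (-(1 / 2))‖ := by
  simp [lpNorm, schattenNorm, weighted, halfDualInv]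

theorem lpNorm_one {σ Y : H →L[ℂ] H} (hσ : 0 ≤ σ) (hY : Y ∈ LSpace σ) :
    lpNorm 1 σ Y = schattenNorm 1 Y := by
  obtain ⟨h1, h2⟩ := (mem_LSpace_iff hσ).1 hY
  simp [lpNorm, weighted, halfDualInv, h1, h2]

theorem bddAbove_lpNorm_top {σ : H →L[ℂ] H} {h : ℂ → H →L[ℂ] H} (hb : ∃ C : ℝ, ∀ z ∈ strip, ‖h z‖ ≤ C) :
    BddAbove (Set.range fun t : ℝ => lpNorm ∞ σ (h (Complex.I * t))) := by
  obtain ⟨C, hC⟩ := hb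
  refine ⟨‖suppPow σ (-(1 / 2))‖ * C * ‖suppPow σ (-(1 / 2))‖, ?_⟩
  rintro _ ⟨t, rfl⟩
  have h1 := hC (Complex.I * t) (by simp [strip])
  simp only [lpNorm_top]
  refine (norm_mul_le _ _).trans ?_
  gcongr
  refine (norm_mul_le _ _).trans ?_
  gcongr

theorem bddAbove_schattenNorm_one {h : ℂ → H →L[ℂ] H} (hb : ∃ C : ℝ, ∀ z ∈ strip, ‖h z‖ ≤ C) :
    BddAbove (Set.range fun t : ℝ => schattenNorm 1 (h (1 + Complex.I * t))) := by
  obtain ⟨C, hC⟩ := hb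
  refine ⟨C * (opTrace (1 : H →L[ℂ] H)).re, ?_⟩
  rintro _ ⟨t, rfl⟩
  refine (schattenNorm_one_le_norm _).trans ?_
  gcongr
  · exact opTrace_nonneg zero_le_one
  · exact hC _ (by simp [strip])

theorem lpNorm_top_le_boundaryMax {σ : H →L[ℂ] H} {h : ℂ → H →L[ℂ] H}
    (hb : ∃ C : ℝ, ∀ z ∈ strip, ‖h z‖ ≤ C) (t : ℝ) :
    lpNorm ∞ σ (h (Complex.I * t)) ≤ boundaryMax σ h :=
  (le_ciSup (bddAbove_lpNorm_top hb) t).trans (le_max_left _ _)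

theorem schattenNorm_one_le_boundaryMax {σ : H →L[ℂ] H} {h : ℂ → H →L[ℂ] H}
    (hb : ∃ C : ℝ, ∀ z ∈ strip, ‖h z‖ ≤ C) (t : ℝ) :
    schattenNorm 1 (h (1 + Complex.I * t)) ≤ boundaryMax σ h :=
  (le_ciSup (bddAbove_schattenNorm_one hb) t).trans (le_max_right _ _)

theorem boundaryMax_nonneg (σ : H →L[ℂ] H) (h : ℂ → H →L[ℂ] H) : 0 ≤ boundaryMax σ h :=
  (Real.iSup_nonneg fun _ => lpNorm_nonneg _ _ _).trans (le_max_left _ _)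

/-- The function that interpolates between the duality pairings of `h` with the operators
`(c P ^ r) ^ (1 - z) W`. -/
def pairing (σ : H →L[ℂ] H) (h : ℂ → H →L[ℂ] H) (P W : H →L[ℂ] H) (r c : ℝ) (z : ℂ) : ℂ :=
  opTrace (suppPow σ (-((1 - z) / 2)) * h z * suppPow σ (-((1 - z) / 2)) *
    (((c : ℂ) ^ (1 - z)) • (suppPow P (r * (1 - z)) * W)))

theorem isStripFun_pairing {σ P : H →L[ℂ] H} (hσ : 0 ≤ σ) (hP : 0 ≤ P) {h : ℂ → H →L[ℂ] H}
    (hh : IsStripFun h) (W : H →L[ℂ] H) (r : ℝ) {c : ℝ} (hc : 0 < c) :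
    IsStripFun (pairing σ h P W r c) := by
  have h1 := isStripFun_suppPow hσ (1 / 2) (-1 / 2)
  have h2 := isStripFun_suppPow hP (-r) r
  have h3 := isStripFun_cpow hc (-1) 1
  have h4 := (((h1.mul hh).mul h1).mul (h3.smul (h2.mul (isStripFun_const W)))).clm opTraceCLM
  convert h4 using 1
  funext z
  have e1 : -((1 - z) / 2) = ((1 / 2 : ℝ) : ℂ) * z + ((-1 / 2 : ℝ) : ℂ) := by push_cast; ring
  have e2 : r * (1 - z) = ((-r : ℝ) : ℂ) * z + r := by push_cast; ring
  have e3 : 1 - z = ((-1 : ℝ) : ℂ) * z + (1 : ℝ) := by push_cast; ring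
  rw [pairing, e1, e2, e3]; rfl

theorem norm_pairing_le {σ P W : H →L[ℂ] H} (hP : 0 ≤ P) (h : ℂ → H →L[ℂ] H)
    (hW : ‖W‖ ≤ 1) {r c : ℝ} (hc : 0 < c) (hcP : c * (opTrace (suppPow P r)).re = 1)
    {θ : ℝ} (hθ : θ ∈ Set.Icc (0 : ℝ) 1) :
    ‖pairing σ h P W r c θ‖ ≤ lpNorm (ENNReal.ofReal θ)⁻¹ σ (h θ) := by
  have := norm_opTrace_mul_le_schattenNorm hP hW hc hcP hθ
    (weighted (ENNReal.ofReal θ)⁻¹ σ (h θ))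
  rwa [lpNorm, pairing, ← weighted_inv_ofReal hθ.1]

/-- On Re z = 0 the weight is σ^(-1/2) times a contraction D, split off on the outer side of each
factor. The dual operator has trace norm at most c Tr P^r = 1. -/
theorem norm_pairing_I_le {σ P W : H →L[ℂ] H} (hσ : 0 ≤ σ) (hP : 0 ≤ P) (h : ℂ → H →L[ℂ] H)
    (hW : ‖W‖ ≤ 1) {r c : ℝ} (hc : 0 < c) (hcP : c * (opTrace (suppPow P r)).re = 1) (t : ℝ) :
    ‖pairing σ h P W r c (Complex.I * t)‖ ≤ lpNorm ∞ σ (h (Complex.I * t)) := by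
  set z : ℂ := Complex.I * t with hz
  set X := suppPow σ (-(1 / 2)) * h z * suppPow σ (-(1 / 2)) with hX
  set D := suppPow σ (z / 2) with hD
  have hD1 : ‖D‖ ≤ 1 := norm_suppPow_I_le hσ (by simp [hz])
  have e1 : suppPow σ (-((1 - z) / 2)) = D * suppPow σ (-(1 / 2)) := by
    rw [hD, suppPow_mul]; ring_nf
  have e2 : suppPow σ (-((1 - z) / 2)) = suppPow σ (-(1 / 2)) * D := by
    rw [hD, suppPow_mul]; ring_nf
  have e3 : suppPow σ (-((1 - z) / 2)) * h z * suppPow σ (-((1 - z) / 2)) = D * X * D := by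
    rw [hX]; nth_rewrite 2 [e2]; rw [e1]; simp only [mul_assoc]
  have e4 : r * (1 - z) = r + Complex.I * ((-r * t : ℝ) : ℂ) := by rw [hz]; push_cast; ring
  have hn : ‖(c : ℂ) ^ (1 - z)‖ = c := by
    rw [Complex.norm_cpow_eq_rpow_re_of_pos hc]; simp [hz]
  rw [pairing, e3, mul_smul_comm, opTrace_smul, norm_mul, hn, ← mul_assoc, opTrace_mul_comm,
    ← mul_assoc, e4, lpNorm_top, ← hX]
  have hle : ‖W * (D * X * D)‖ ≤ ‖X‖ := by
    calc _ ≤ ‖W‖ * (‖D‖ * ‖X‖ * ‖D‖) := by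
          refine (norm_mul_le _ _).trans ?_
          gcongr
          refine (norm_mul_le _ _).trans ?_
          gcongr
          exact norm_mul_le _ _
      _ ≤ 1 * (1 * ‖X‖ * 1) := by gcongr
      _ = ‖X‖ := by ring
  calc _ ≤ c * (‖W * (D * X * D)‖ * (opTrace (suppPow P r)).re) := by
        gcongr; exact norm_opTrace_mul_suppPow_le hP _ _ _
    _ = ‖W * (D * X * D)‖ * (c * (opTrace (suppPow P r)).re) := by ring
    _ ≤ ‖X‖ := by rw [hcP, mul_one]; exact hle

/-- On Re z = 1 all operator exponents are imaginary and the scalar has modulus 1, so only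
contractions multiply h. -/
theorem norm_pairing_one_add_I_le {σ P W : H →L[ℂ] H} (hσ : 0 ≤ σ) (hP : 0 ≤ P)
    (h : ℂ → H →L[ℂ] H) (hW : ‖W‖ ≤ 1) (r : ℝ) {c : ℝ} (hc : 0 < c) (t : ℝ) :
    ‖pairing σ h P W r c (1 + Complex.I * t)‖ ≤ schattenNorm 1 (h (1 + Complex.I * t)) := by
  set z : ℂ := 1 + Complex.I * t with hz
  have hn : ‖(c : ℂ) ^ (1 - z)‖ = 1 := by
    rw [Complex.norm_cpow_eq_rpow_re_of_pos hc]; simp [hz]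
  have hD : ‖suppPow σ (-((1 - z) / 2))‖ ≤ 1 := norm_suppPow_I_le hσ (by simp [hz])
  have hQ : ‖suppPow P (r * (1 - z))‖ ≤ 1 := norm_suppPow_I_le hP (by simp [hz])
  rw [pairing, mul_smul_comm, opTrace_smul, norm_mul, hn, one_mul, opTrace_mul_comm]
  refine (norm_opTrace_mul_le_schattenNorm_one _ _).trans ?_
  calc _ ≤ 1 * schattenNorm 1 _ := by
        gcongr
        · exact schattenNorm_nonneg _ _
        · exact norm_mul_le_one hQ hW
    _ ≤ _ := by rw [one_mul]; exact schattenNorm_one_mul_mul_le hD hD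

/-- A pairing function that is bounded by `boundaryMax σ h` and attains a given norm. -/
theorem exists_pairing {σ : H →L[ℂ] H} (hσ : 0 ≤ σ) {h : ℂ → H →L[ℂ] H} (hh : IsStripFun h)
    {θ : ℝ} (hθ : θ ∈ Set.Ioo (0 : ℝ) 1) (hN : lpNorm (ENNReal.ofReal θ)⁻¹ σ (h θ) ≠ 0) :
    ∃ φ : ℂ → ℂ, IsStripFun φ ∧ (∀ z ∈ strip, ‖φ z‖ ≤ boundaryMax σ h) ∧
      φ θ = lpNorm (ENNReal.ofReal θ)⁻¹ σ (h θ) ∧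
      ∀ η ∈ Set.Icc (0 : ℝ) 1, ‖φ η‖ ≤ lpNorm (ENNReal.ofReal η)⁻¹ σ (h η) := by
  set X := weighted (ENNReal.ofReal θ)⁻¹ σ (h θ) with hX
  have hP := CFC.abs_nonneg X
  have hτ : 0 < (opTrace (suppPow (CFC.abs X) ((θ⁻¹ : ℝ) : ℂ))).re := by
    refine lt_of_le_of_ne (opTrace_nonneg (suppPow_nonneg hP _)) fun h0 => hN ?_
    rw [lpNorm, ← hX, schattenNorm_inv_ofReal hθ.1, ← h0, Real.zero_rpow hθ.1.ne']
  have hW : ‖star (polarPart X)‖ ≤ 1 := by rw [norm_star]; exact norm_polarPart_le X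
  have hc := inv_pos.2 hτ
  have hcP := inv_mul_cancel₀ hτ.ne'
  -- The choice P = |X|, W = U*, r = 1/θ, c = 1/Tr |X|^r makes the dual operator norming for X at z
  -- = θ.
  have hφ := isStripFun_pairing hσ hP hh (star (polarPart X)) θ⁻¹ hc
  refine ⟨_, hφ, fun z hz => ?_, ?_, fun η hη => norm_pairing_le hP h hW hc hcP hη⟩
  · exact hφ.norm_le
      (fun t => (norm_pairing_I_le hσ hP h hW hc hcP t).trans (lpNorm_top_le_boundaryMax hh.1 t))
      (fun t => (norm_pairing_one_add_I_le hσ hP h hW _ hc t).trans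
        (schattenNorm_one_le_boundaryMax hh.1 t)) hz
  · have := opTrace_mul_dual hθ.1 hτ
    rw [lpNorm, ← hX, ← this, pairing, hX, weighted_inv_ofReal hθ.1.le]

/-- The three lines theorem for the weighted norms. -/
theorem lpNorm_le_boundaryMax {σ : H →L[ℂ] H} (hσ : 0 ≤ σ) {h : ℂ → H →L[ℂ] H}
    (hL : ∀ z ∈ strip, h z ∈ LSpace σ) (hh : IsStripFun h) {θ : ℝ}
    (hθ : θ ∈ Set.Icc (0 : ℝ) 1) : lpNorm (ENNReal.ofReal θ)⁻¹ σ (h θ) ≤ boundaryMax σ h := by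
  rcases hθ.1.eq_or_lt with rfl | h0
  · simpa using lpNorm_top_le_boundaryMax (σ := σ) hh.1 0
  rcases hθ.2.eq_or_lt with rfl | h1
  · have := schattenNorm_one_le_boundaryMax (σ := σ) hh.1 0
    rw [← lpNorm_one hσ (hL _ (by simp [strip]))] at this
    simpa using this
  by_cases hN : lpNorm (ENNReal.ofReal θ)⁻¹ σ (h θ) = 0
  · rw [hN]; exact boundaryMax_nonneg σ h
  · obtain ⟨φ, -, hφ, hφθ, -⟩ := exists_pairing hσ hh ⟨h0, h1⟩ hN
    have := hφ _ (ofReal_mem_strip hθ)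
    rwa [hφθ, Complex.norm_of_nonneg (lpNorm_nonneg _ _ _)] at this

/-- Equality in the three lines theorem propagates to the whole segment. -/
theorem lpNorm_eq_boundaryMax {σ : H →L[ℂ] H} (hσ : 0 ≤ σ) {h : ℂ → H →L[ℂ] H}
    (hL : ∀ z ∈ strip, h z ∈ LSpace σ) (hh : IsStripFun h) {θ : ℝ}
    (hθ : θ ∈ Set.Ioo (0 : ℝ) 1) (heq : lpNorm (ENNReal.ofReal θ)⁻¹ σ (h θ) = boundaryMax σ h)
    {η : ℝ} (hη : η ∈ Set.Icc (0 : ℝ) 1) :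
    lpNorm (ENNReal.ofReal η)⁻¹ σ (h η) = boundaryMax σ h := by
  refine le_antisymm (lpNorm_le_boundaryMax hσ hL hh hη) ?_
  by_cases hN : lpNorm (ENNReal.ofReal θ)⁻¹ σ (h θ) = 0
  · rw [← heq, hN]; exact lpNorm_nonneg _ _ _
  · obtain ⟨φ, hφs, hφ, hφθ, hφη⟩ := exists_pairing hσ hh hθ hN
    have hmem : (θ : ℂ) ∈ interior strip := by rw [interior_strip]; exact hθ
    -- |φ| attains its bound at the interior point θ, hence is constant; at η it is a lower bound
    -- for the norm.
    have h1 := hφs.norm_eq hφ hmem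
      (by rw [hφθ, Complex.norm_of_nonneg (lpNorm_nonneg _ _ _), heq]) (ofReal_mem_strip hη)
    rw [← h1]
    exact hφη η hη

variable {K : Type*} [NormedAddCommGroup K] [InnerProductSpace ℂ K] [CompleteSpace K]
variable [FiniteDimensional ℂ K]

/-! ### Positive maps -/

theorem IsPositiveMap.map_nonneg {Φ : (H →L[ℂ] H) →ₗ[ℂ] (K →L[ℂ] K)} (hΦ : IsPositiveMap Φ)
    {X : H →L[ℂ] H} (hX : 0 ≤ X) : 0 ≤ Φ X :=
  (ContinuousLinearMap.nonneg_iff_isPositive _).2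
    (hΦ X ((ContinuousLinearMap.nonneg_iff_isPositive X).1 hX))

/-- Cauchy–Schwarz followed by the arithmetic-geometric mean inequality; the additive form can be
summed over spectral projections. -/
theorem norm_inner_apply_le {A : H →L[ℂ] H} (hA : 0 ≤ A) (x y : H) :
    ‖(inner ℂ y (A x) : ℂ)‖ ≤ ((inner ℂ y (A y) : ℂ).re + (inner ℂ x (A x) : ℂ).re) / 2 := by
  obtain ⟨Q, hQ, rfl⟩ := exists_self_adjoint_sqrt hA
  have h : ∀ u v : H, (inner ℂ u ((Q * Q) v) : ℂ) = inner ℂ (Q u) (Q v) := fun u v => by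
    rw [mul_apply_eq_comp, ← inner_star_apply, hQ]
  have h2 : ∀ u : H, (inner ℂ (Q u) (Q u) : ℂ).re = ‖Q u‖ ^ 2 := fun u =>
    inner_self_eq_norm_sq (𝕜 := ℂ) _
  rw [h, h, h, h2, h2]
  have h3 := norm_inner_le_norm (𝕜 := ℂ) (Q y) (Q x)
  nlinarith [sq_nonneg (‖Q y‖ - ‖Q x‖)]

theorem norm_le_one_of_inner_le {T : H →L[ℂ] H}
    (h : ∀ x y : H, ‖(inner ℂ y (T x) : ℂ)‖ ≤ (‖y‖ ^ 2 + ‖x‖ ^ 2) / 2) : ‖T‖ ≤ 1 := by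
  refine ContinuousLinearMap.opNorm_le_bound _ zero_le_one fun x => ?_
  rw [one_mul]
  rcases (norm_nonneg (T x)).eq_or_lt with h0 | hb
  · rw [← h0]; exact norm_nonneg x
  have ha : 0 < ‖x‖ := by
    rw [norm_pos_iff]; rintro rfl; simp at hb
  -- The test vector is T x rescaled to the length of x, which balances the two squares.
  have h1 := h x (((‖x‖ / ‖T x‖ : ℝ) : ℂ) • T x)
  rw [inner_smul_left, norm_mul, norm_smul, inner_self_eq_norm_sq_to_K] at h1
  simp only [RCLike.norm_conj, Complex.norm_real, norm_div, norm_norm, norm_pow,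
    Complex.coe_algebraMap] at h1
  rw [div_mul_cancel₀ _ hb.ne'] at h1
  have e : ‖x‖ / ‖T x‖ * ‖T x‖ ^ 2 = ‖x‖ * ‖T x‖ := by field_simp
  rw [e] at h1
  nlinarith

/-- In U = ∑ w P_w every |w| is 1, and the positive operators Φ(P_w) sum to Φ(1) ≤ 1, so the
termwise Cauchy–Schwarz bounds add up. -/
theorem IsPositiveMap.norm_map_unitary_le {Φ : (H →L[ℂ] H) →ₗ[ℂ] (K →L[ℂ] K)}
    (hΦ : IsPositiveMap Φ) (h1 : Φ 1 ≤ 1) {U : H →L[ℂ] H} (hU : U ∈ unitary (H →L[ℂ] H)) :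
    ‖Φ U‖ ≤ 1 := by
  have hn : IsStarNormal U := ⟨by
    rw [commute_iff_eq, (Unitary.mem_iff.1 hU).1, (Unitary.mem_iff.1 hU).2]⟩
  have hUs : U = ∑ w ∈ specFinset U, w • specProj U w := by
    conv_lhs => rw [← cfc_id ℂ U]
    exact cfc_eq_sum_specProj _
  have h1s : (1 : H →L[ℂ] H) = ∑ w ∈ specFinset U, specProj U w := by
    rw [← cfc_one ℂ U, cfc_eq_sum_specProj]; simp
  refine norm_le_one_of_inner_le fun x y => ?_
  have hx : ∀ u : K, ∑ w ∈ specFinset U, (inner ℂ u (Φ (specProj U w) u) : ℂ).re ≤ ‖u‖ ^ 2 := by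
    intro u
    have h2 := ((ContinuousLinearMap.le_def _ _).1 h1).re_inner_nonneg_right u
    rw [h1s, map_sum, sub_apply, sum_apply, one_apply_eq_self, inner_sub_right,
      inner_sum, map_sub, map_sum, inner_self_eq_norm_sq, sub_nonneg] at h2
    exact h2
  calc ‖(inner ℂ y (Φ U x) : ℂ)‖
      = ‖∑ w ∈ specFinset U, w * (inner ℂ y (Φ (specProj U w) x) : ℂ)‖ := by
        conv_lhs => rw [hUs]
        simp
    _ ≤ ∑ w ∈ specFinset U, ((inner ℂ y (Φ (specProj U w) y) : ℂ).re
          + (inner ℂ x (Φ (specProj U w) x) : ℂ).re) / 2 := by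
        refine (norm_sum_le _ _).trans (Finset.sum_le_sum fun w hw => ?_)
        have hw1 : ‖w‖ = 1 := by
          simpa using spectrum.subset_circle_of_unitary hU (mem_specFinset.1 hw)
        rw [norm_mul, hw1, one_mul]
        exact norm_inner_apply_le (hΦ.map_nonneg (specProj_nonneg U w)) x y
    _ ≤ _ := by
        rw [← Finset.sum_div, Finset.sum_add_distrib]
        have := hx x; have := hx y
        linarith

/-- Cancelling X in X |X|^0 = X gives U*U = 1, and |X| X⁻¹ is a right inverse of U. -/
theorem polarPart_mem_unitary {X : H →L[ℂ] H} (hX : IsUnit X) :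
    polarPart X ∈ unitary (H →L[ℂ] H) := by
  obtain ⟨u, rfl⟩ := hX
  have h1 : suppPow (CFC.abs (u : H →L[ℂ] H)) 0 = 1 := by
    have := mul_supp (u : H →L[ℂ] H)
    simpa using congrArg (fun Z => (↑u⁻¹ : H →L[ℂ] H) * Z) this
  have h2 := polar_initial (u : H →L[ℂ] H)
  rw [h1] at h2
  have h3 : polarPart (u : H →L[ℂ] H) * (CFC.abs (u : H →L[ℂ] H) * ↑u⁻¹) = 1 := by
    rw [← mul_assoc, polar_mul_abs, Units.mul_inv]
  have h4 := left_inv_eq_right_inv h2 h3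
  exact Unitary.mem_iff.2 ⟨h2, by rw [h4, h3]⟩

/-- The contraction a = |X|/‖X‖ is the real part of the unitary V = a + i√(1 - a²), so X is ‖X‖
times the average of the unitaries UV and UV*. -/
theorem IsPositiveMap.norm_map_le_of_isUnit {Φ : (H →L[ℂ] H) →ₗ[ℂ] (K →L[ℂ] K)}
    (hΦ : IsPositiveMap Φ) (h1 : Φ 1 ≤ 1) {X : H →L[ℂ] H} (hX : IsUnit X) : ‖Φ X‖ ≤ ‖X‖ := by
  rcases eq_or_ne X 0 with rfl | h0
  · simp
  have hn : ‖X‖ ≠ 0 := norm_ne_zero_iff.2 h0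
  obtain ⟨a, ha⟩ : ∃ a : H →L[ℂ] H, a = ((‖X‖⁻¹ : ℝ) : ℂ) • CFC.abs X := ⟨_, rfl⟩
  have hr : IsSelfAdjoint ((‖X‖⁻¹ : ℝ) : ℂ) := Complex.conj_ofReal _
  have hsa : IsSelfAdjoint a := by
    rw [ha]; exact hr.smul (IsSelfAdjoint.of_nonneg (CFC.abs_nonneg X))
  have ha1 : ‖a‖ ≤ 1 := by
    rw [ha, norm_smul, CFC.norm_abs, Complex.norm_real, norm_inv, norm_norm, inv_mul_cancel₀ hn]
  set V := a + Complex.I • CFC.sqrt (1 - a ^ 2) with hV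
  have hVu : V ∈ unitary (H →L[ℂ] H) := hsa.self_add_I_smul_cfcSqrt_sub_sq_mem_unitary _ ha1
  have hVs : V + star V = (2 : ℂ) • a := by
    have hs : star (CFC.sqrt (1 - a ^ 2)) = CFC.sqrt (1 - a ^ 2) :=
      (IsSelfAdjoint.of_nonneg (CFC.sqrt_nonneg (1 - a ^ 2))).star_eq
    rw [hV, star_add, star_smul, hsa.star_eq, hs]
    simp only [RCLike.star_def, Complex.conj_I, neg_smul, two_smul]
    abel
  have hU := polarPart_mem_unitary hX
  have hXe : X = ((‖X‖ / 2 : ℝ) : ℂ) • (polarPart X * V + polarPart X * star V) := by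
    rw [← mul_add, hVs, ha, smul_smul, mul_smul_comm, polar_mul_abs, smul_smul]
    have : ((‖X‖ / 2 : ℝ) : ℂ) * (2 * ((‖X‖⁻¹ : ℝ) : ℂ)) = 1 := by
      have : (‖X‖ : ℂ) ≠ 0 := by exact_mod_cast hn
      push_cast; field_simp
    rw [this, one_smul]
  have hA := hΦ.norm_map_unitary_le h1 (mul_mem hU hVu)
  have hB := hΦ.norm_map_unitary_le h1 (mul_mem hU (Unitary.star_mem hVu))
  have hAB := norm_add_le (Φ (polarPart X * V)) (Φ (polarPart X * star V))
  calc ‖Φ X‖ = ‖X‖ / 2 * ‖Φ (polarPart X * V) + Φ (polarPart X * star V)‖ := by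
        conv_lhs => rw [hXe]
        rw [map_smul, map_add, norm_smul, Complex.norm_real, norm_div, norm_norm]
        simp
    _ ≤ ‖X‖ / 2 * 2 := by gcongr; linarith
    _ = ‖X‖ := by ring

/-- The Russo–Dye theorem: a positive subunital map is a contraction. -/
theorem IsPositiveMap.norm_map_le {Φ : (H →L[ℂ] H) →ₗ[ℂ] (K →L[ℂ] K)} (hΦ : IsPositiveMap Φ)
    (h1 : Φ 1 ≤ 1) (X : H →L[ℂ] H) : ‖Φ X‖ ≤ ‖X‖ := by
  have hΦc : Continuous Φ := LinearMap.continuous_of_finiteDimensional Φ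
  have hc : Continuous fun c : ℂ => X - algebraMap ℂ (H →L[ℂ] H) c := by fun_prop
  have hlim : Filter.Tendsto (fun c : ℂ => X - algebraMap ℂ (H →L[ℂ] H) c) (nhdsWithin 0 {0}ᶜ)
      (nhds X) := by
    have := hc.tendsto 0
    rw [map_zero, sub_zero] at this
    exact this.mono_left nhdsWithin_le_nhds
  -- The spectrum is finite, so X - c is invertible for all small c ≠ 0, and X is a limit of
  -- invertibles.
  have hunit : ∀ᶠ c : ℂ in nhdsWithin 0 {0}ᶜ, IsUnit (X - algebraMap ℂ (H →L[ℂ] H) c) := by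
    have hfin : (spectrum ℂ X \ {0}).Finite := by
      refine Set.Finite.subset ?_ Set.sdiff_subset
      rw [ContinuousLinearMap.spectrum_eq]; exact Module.End.finite_spectrum _
    have h2 : (spectrum ℂ X \ {0})ᶜ ∈ nhds (0 : ℂ) := hfin.isClosed.isOpen_compl.mem_nhds (by simp)
    filter_upwards [mem_nhdsWithin_of_mem_nhds h2, self_mem_nhdsWithin] with c hc hc0
    have h3 : c ∉ spectrum ℂ X := fun h => hc ⟨h, hc0⟩
    rw [spectrum.notMem_iff] at h3
    rw [← neg_sub]
    exact h3.neg
  refine le_of_tendsto_of_tendsto ((hΦc.tendsto X).comp hlim).norm hlim.norm ?_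
  filter_upwards [hunit] with c hc
  exact hΦ.norm_map_le_of_isUnit h1 hc

/-- The adjoint of a map for the trace pairing. -/
def traceAdjoint (Φ : (H →L[ℂ] H) →ₗ[ℂ] (K →L[ℂ] K)) : (K →L[ℂ] K) →ₗ[ℂ] (H →L[ℂ] H) where
  toFun B := ∑ i, ∑ j, opTrace (B * Φ (InnerProductSpace.rankOne ℂ (stdOrthonormalBasis ℂ H i)
    (stdOrthonormalBasis ℂ H j))) • InnerProductSpace.rankOne ℂ (stdOrthonormalBasis ℂ H j)
      (stdOrthonormalBasis ℂ H i)
  map_add' A B := by simp only [add_mul, opTrace_add, add_smul, Finset.sum_add_distrib]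
  map_smul' c A := by
    simp only [smul_mul_assoc, opTrace_smul, mul_smul, Finset.smul_sum, RingHom.id_apply]

theorem eq_sum_rankOne {ι : Type*} [Fintype ι] (b : OrthonormalBasis ι ℂ H) (X : H →L[ℂ] H) :
    X = ∑ i, ∑ j, (inner ℂ (b i) (X (b j)) : ℂ) • InnerProductSpace.rankOne ℂ (b i) (b j) := by
  ext y
  simp only [sum_apply, smul_apply, InnerProductSpace.rankOne_apply]
  conv_lhs => rw [← b.sum_repr' (X y)]
  refine Finset.sum_congr rfl fun i _ => ?_
  conv_lhs => rw [← b.sum_repr' y]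
  rw [map_sum, inner_sum, Finset.sum_smul]
  refine Finset.sum_congr rfl fun j _ => ?_
  rw [map_smul, inner_smul_right, smul_smul, mul_comm]

theorem opTrace_traceAdjoint_mul (Φ : (H →L[ℂ] H) →ₗ[ℂ] (K →L[ℂ] K)) (B : K →L[ℂ] K)
    (X : H →L[ℂ] H) : opTrace (traceAdjoint Φ B * X) = opTrace (B * Φ X) := by
  conv_rhs => rw [eq_sum_rankOne (stdOrthonormalBasis ℂ H) X]
  simp only [traceAdjoint, LinearMap.coe_mk, AddHom.coe_mk, ← opTraceCLM_apply, map_sum,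
    Finset.sum_mul, Finset.mul_sum, map_smul, smul_mul_assoc, mul_smul_comm, smul_eq_mul]
  refine Finset.sum_congr rfl fun i _ => Finset.sum_congr rfl fun j _ => ?_
  rw [mul_comm]
  congr 1
  rw [opTraceCLM_apply, opTrace_mul_comm, opTrace_mul_rankOne]

theorem opTrace_mul_nonneg {A B : H →L[ℂ] H} (hA : 0 ≤ A) (hB : 0 ≤ B) : 0 ≤ opTrace (A * B) := by
  obtain ⟨Q, hQ, rfl⟩ := exists_self_adjoint_sqrt hA
  have h : 0 ≤ Q * B * Q := by
    have := star_left_conjugate_nonneg hB Q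
    rwa [hQ] at this
  rw [mul_assoc, opTrace_mul_comm, opTrace_eq_ofReal h]
  exact_mod_cast opTrace_nonneg h

theorem rankOne_self_nonneg (x : H) : 0 ≤ InnerProductSpace.rankOne ℂ x x :=
  (ContinuousLinearMap.nonneg_iff_isPositive _).2 (InnerProductSpace.isPositive_rankOne_self x)

/-- The quadratic form of the adjoint of B at x is, up to conjugation, Tr(B Φ(|x⟩⟨x|)), a trace of a
product of positive operators. -/
theorem IsPositiveMap.traceAdjoint {Φ : (H →L[ℂ] H) →ₗ[ℂ] (K →L[ℂ] K)} (hΦ : IsPositiveMap Φ) :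
    IsPositiveMap (traceAdjoint Φ) := by
  intro B hB
  rw [← ContinuousLinearMap.nonneg_iff_isPositive] at hB
  rw [ContinuousLinearMap.isPositive_iff_complex]
  intro x
  have h := opTrace_mul_nonneg hB (hΦ.map_nonneg (rankOne_self_nonneg x))
  rw [← opTrace_traceAdjoint_mul, opTrace_mul_rankOne, ← inner_conj_symm, Complex.le_def,
    Complex.conj_re, Complex.conj_im] at h
  refine ⟨Complex.ext ?_ ?_, ?_⟩
  · simp
  · have h2 := h.2
    simp only [Complex.zero_im, zero_eq_neg] at h2
    simp [h2]
  · simpa using h.1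

theorem traceAdjoint_one {Φ : (H →L[ℂ] H) →ₗ[ℂ] (K →L[ℂ] K)} (hΦ : IsTracePreserving Φ) :
    traceAdjoint Φ 1 = 1 := by
  ext x
  refine ext_inner_left ℂ fun y => ?_
  rw [← opTrace_mul_rankOne, opTrace_traceAdjoint_mul, one_mul, hΦ, ← opTrace_mul_rankOne, one_mul]

/-- By duality: the trace adjoint is positive and unital, so Russo–Dye keeps the test operator W in
the unit ball. -/
theorem schattenNorm_one_map_le {Φ : (H →L[ℂ] H) →ₗ[ℂ] (K →L[ℂ] K)} (hΦ : IsPositiveMap Φ)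
    (hT : IsTracePreserving Φ) (X : H →L[ℂ] H) : schattenNorm 1 (Φ X) ≤ schattenNorm 1 X := by
  refine schattenNorm_one_le fun W hW => ?_
  rw [← opTrace_traceAdjoint_mul]
  refine (norm_opTrace_mul_le_schattenNorm_one _ _).trans ?_
  refine mul_le_of_le_one_left (schattenNorm_nonneg _ _) ?_
  exact (hΦ.traceAdjoint.norm_map_le (traceAdjoint_one hT).le W).trans hW

/-! ### Supports and the weighted operator norm under positive maps -/

/-- Domination forces ker ρ ≤ ker Z; the range condition follows by taking adjoints. -/
theorem mem_LSpace_of_le {Z ρ : H →L[ℂ] H} (hρ : 0 ≤ ρ) (hZ : 0 ≤ Z) {c : ℝ}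
    (h : Z ≤ (c : ℂ) • ρ) : Z ∈ LSpace ρ := by
  have hn : IsStarNormal ρ := (IsSelfAdjoint.of_nonneg hρ).isStarNormal
  have hE : star (suppPow ρ 0) = suppPow ρ 0 := by simpa using suppPow_star hρ 0
  have hker : ∀ x, ρ x = 0 → Z x = 0 := fun x hx => by
    have h1 := ((ContinuousLinearMap.le_def _ _).1 h).re_inner_nonneg_right x
    rw [sub_apply, smul_apply, hx, smul_zero, zero_sub, inner_neg_right, map_neg] at h1
    obtain ⟨Q, hQ, rfl⟩ := exists_self_adjoint_sqrt hZ
    rw [mul_apply_eq_comp, ← inner_star_apply, hQ, inner_self_eq_norm_sq] at h1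
    have h2 : Q x = 0 := by
      rw [← norm_eq_zero]; nlinarith [sq_nonneg ‖Q x‖]
    rw [mul_apply_eq_comp, h2, map_zero]
  have hZE : Z * suppPow ρ 0 = Z := by
    ext x
    have h1 : ρ (suppPow ρ 0 x - x) = 0 := by
      have h := suppPow_mul ρ 1 0
      rw [add_zero, suppPow_one hn] at h
      rw [map_sub, ← mul_apply_eq_comp, h, sub_self]
    have h2 := hker _ h1
    rw [map_sub, sub_eq_zero] at h2
    exact h2
  refine (mem_LSpace_iff hρ).2 ⟨?_, hZE⟩
  have := congrArg star hZE
  rwa [star_mul, hE, (IsSelfAdjoint.of_nonneg hZ).star_eq] at this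

theorem suppPow_half_mul_self {σ : H →L[ℂ] H} (hσ : 0 ≤ σ) :
    suppPow σ (1 / 2) * suppPow σ (1 / 2) = σ := by
  rw [suppPow_mul, add_halves, suppPow_one (IsSelfAdjoint.of_nonneg hσ).isStarNormal]

/-- Conjugation `X ↦ A X A` followed by `Φ` and by conjugation `Z ↦ B Z B`. -/
def conjMap (Φ : (H →L[ℂ] H) →ₗ[ℂ] (K →L[ℂ] K)) (A : H →L[ℂ] H) (B : K →L[ℂ] K) :
    (H →L[ℂ] H) →ₗ[ℂ] (K →L[ℂ] K) where
  toFun X := B * Φ (A * X * A) * B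
  map_add' X Y := by simp only [mul_add, add_mul, map_add]
  map_smul' c X := by simp

theorem IsPositiveMap.conjMap {Φ : (H →L[ℂ] H) →ₗ[ℂ] (K →L[ℂ] K)} (hΦ : IsPositiveMap Φ)
    {A : H →L[ℂ] H} {B : K →L[ℂ] K} (hA : star A = A) (hB : star B = B) :
    IsPositiveMap (conjMap Φ A B) := by
  intro X hX
  rw [← ContinuousLinearMap.nonneg_iff_isPositive] at hX ⊢
  have h1 := star_left_conjugate_nonneg hX A
  rw [hA] at h1
  have h2 := star_left_conjugate_nonneg (hΦ.map_nonneg h1) B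
  rwa [hB] at h2

theorem eq_half_mul_weighted {σ Y : H →L[ℂ] H} (hσ : 0 ≤ σ) (hY : Y ∈ LSpace σ) :
    suppPow σ (1 / 2) * (suppPow σ (-(1 / 2)) * Y * suppPow σ (-(1 / 2))) * suppPow σ (1 / 2)
      = Y := by
  obtain ⟨h1, h2⟩ := (mem_LSpace_iff hσ).1 hY
  rw [← mul_assoc, ← mul_assoc, suppPow_mul, mul_assoc _ (suppPow σ (-(1 / 2))), suppPow_mul,
    add_neg_cancel, neg_add_cancel, h1, h2]

theorem LSpace_add {σ Y Z : H →L[ℂ] H} (hσ : 0 ≤ σ) (hY : Y ∈ LSpace σ) (hZ : Z ∈ LSpace σ) :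
    Y + Z ∈ LSpace σ := by
  rw [mem_LSpace_iff hσ] at *
  rw [mul_add, add_mul, hY.1, hY.2, hZ.1, hZ.2]
  exact ⟨rfl, rfl⟩

theorem LSpace_smul {σ Y : H →L[ℂ] H} (hσ : 0 ≤ σ) (hY : Y ∈ LSpace σ) (c : ℂ) :
    c • Y ∈ LSpace σ := by
  rw [mem_LSpace_iff hσ] at *
  rw [mul_smul_comm, smul_mul_assoc, hY.1, hY.2]
  exact ⟨rfl, rfl⟩

/-- Y = σ^(1/2) X σ^(1/2) and X is a combination of positive operators; for X ≥ 0 the bound X ≤ ‖X‖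
gives Φ(σ^(1/2) X σ^(1/2)) ≤ ‖X‖ Φ(σ). -/
theorem map_mem_LSpace {Φ : (H →L[ℂ] H) →ₗ[ℂ] (K →L[ℂ] K)} (hΦ : IsPositiveMap Φ)
    {σ Y : H →L[ℂ] H} (hσ : 0 ≤ σ) (hY : Y ∈ LSpace σ) : Φ Y ∈ LSpace (Φ σ) := by
  have hρ := hΦ.map_nonneg hσ
  have hs : star (suppPow σ (1 / 2)) = suppPow σ (1 / 2) := by
    simpa using suppPow_star hσ (1 / 2)
  have hpos := hΦ.conjMap hs (star_one (K →L[ℂ] K))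
  have key : ∀ X : H →L[ℂ] H, conjMap Φ (suppPow σ (1 / 2)) 1 X ∈ LSpace (Φ σ) := by
    intro X
    have hX : X ∈ Submodule.span ℂ {a : H →L[ℂ] H | 0 ≤ a} := by
      rw [CStarAlgebra.span_nonneg]; trivial
    induction hX using Submodule.span_induction with
    | mem X hX =>
      have hX : 0 ≤ X := hX
      refine mem_LSpace_of_le (c := ‖X‖) hρ (hpos.map_nonneg hX) ?_
      have h1 : 0 ≤ (‖X‖ : ℂ) • (1 : H →L[ℂ] H) - X := by
        have := (IsSelfAdjoint.of_nonneg hX).le_algebraMap_norm_self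
        rw [← sub_nonneg, Algebra.algebraMap_eq_smul_one] at this
        exact this
      have h2 := hpos.map_nonneg h1
      rw [map_sub, map_smul, sub_nonneg] at h2
      have e : conjMap Φ (suppPow σ (1 / 2)) 1 1 = Φ σ := by
        simp only [conjMap, LinearMap.coe_mk, AddHom.coe_mk, one_mul, mul_one,
          suppPow_half_mul_self hσ]
      rwa [e] at h2
    | zero => rw [map_zero]; exact (mem_LSpace_iff hρ).2 (by simp)
    | add X Y _ _ hX hY => rw [map_add]; exact LSpace_add hρ hX hY
    | smul c X _ hX => rw [map_smul]; exact LSpace_smul hρ hX c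
  have h := key (suppPow σ (-(1 / 2)) * Y * suppPow σ (-(1 / 2)))
  simpa only [conjMap, LinearMap.coe_mk, AddHom.coe_mk, one_mul, mul_one,
    eq_half_mul_weighted hσ hY] using h

theorem suppPow_zero_le_one (A : H →L[ℂ] H) : suppPow A 0 ≤ 1 := by
  refine cfc_le_one _ _ fun x _ => ?_
  split_ifs <;> simp

/-- Russo–Dye for the conjugated map, whose value at 1 is the support projection of Φ(σ). -/
theorem lpNorm_top_map_le {Φ : (H →L[ℂ] H) →ₗ[ℂ] (K →L[ℂ] K)} (hΦ : IsPositiveMap Φ)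
    {σ Y : H →L[ℂ] H} (hσ : 0 ≤ σ) (hY : Y ∈ LSpace σ) : lpNorm ∞ (Φ σ) (Φ Y) ≤ lpNorm ∞ σ Y := by
  have hρ := hΦ.map_nonneg hσ
  have hs : star (suppPow σ (1 / 2)) = suppPow σ (1 / 2) := by
    simpa using suppPow_star hσ (1 / 2)
  have hr : star (suppPow (Φ σ) (-(1 / 2))) = suppPow (Φ σ) (-(1 / 2)) := by
    simpa using suppPow_star hρ (-(1 / 2))
  have h1 : conjMap Φ (suppPow σ (1 / 2)) (suppPow (Φ σ) (-(1 / 2))) 1 ≤ 1 := by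
    have e : conjMap Φ (suppPow σ (1 / 2)) (suppPow (Φ σ) (-(1 / 2))) 1 = suppPow (Φ σ) 0 := by
      simp only [conjMap, LinearMap.coe_mk, AddHom.coe_mk, mul_one, suppPow_half_mul_self hσ]
      nth_rw 2 [← suppPow_one (IsSelfAdjoint.of_nonneg hρ).isStarNormal]
      rw [suppPow_mul, suppPow_mul]
      norm_num
    rw [e]; exact suppPow_zero_le_one _
  have h := (hΦ.conjMap hs hr).norm_map_le h1 (suppPow σ (-(1 / 2)) * Y * suppPow σ (-(1 / 2)))
  simp only [conjMap, LinearMap.coe_mk, AddHom.coe_mk, eq_half_mul_weighted hσ hY] at h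
  rwa [lpNorm_top, lpNorm_top]

/-! ### The interpolating family -/

theorem boundaryMax_le {σ : H →L[ℂ] H} {h : ℂ → H →L[ℂ] H} {N : ℝ}
    (h0 : ∀ t : ℝ, lpNorm ∞ σ (h (Complex.I * t)) ≤ N)
    (h1 : ∀ t : ℝ, schattenNorm 1 (h (1 + Complex.I * t)) ≤ N) : boundaryMax σ h ≤ N :=
  max_le (ciSup_le h0) (ciSup_le h1)

theorem inv_ofReal_inv {p : ℝ} (hp : 0 < p) : (ENNReal.ofReal p⁻¹)⁻¹ = ENNReal.ofReal p := by
  rw [ENNReal.ofReal_inv_of_pos hp, inv_inv]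

theorem interpFamily_eq (σ Y : H →L[ℂ] H) (p : ℝ) (z : ℂ) :
    interpFamily σ Y p z = ((lpNorm (ENNReal.ofReal p) σ Y : ℂ) ^ (1 - z * p)) •
      (suppPow σ ((1 - z) / 2) * polarPart (weighted (ENNReal.ofReal p) σ Y) *
        suppPow (CFC.abs (weighted (ENNReal.ofReal p) σ Y)) (z * p) * suppPow σ ((1 - z) / 2)) :=
  rfl

theorem interpFamily_mem_LSpace {σ : H →L[ℂ] H} (hσ : 0 ≤ σ) (Y : H →L[ℂ] H) (p : ℝ) (z : ℂ) :
    interpFamily σ Y p z ∈ LSpace σ := by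
  rw [interpFamily_eq]
  refine LSpace_smul hσ ((mem_LSpace_iff hσ).2 ⟨?_, ?_⟩) _
  · rw [← mul_assoc, ← mul_assoc, ← mul_assoc, suppPow_mul, zero_add]
  · rw [mul_assoc, suppPow_mul, add_zero]

theorem isStripFun_interpFamily {σ : H →L[ℂ] H} (hσ : 0 ≤ σ) {Y : H →L[ℂ] H} {p : ℝ}
    (hN : 0 < lpNorm (ENNReal.ofReal p) σ Y) : IsStripFun (interpFamily σ Y p) := by
  set X := weighted (ENNReal.ofReal p) σ Y
  have h1 := isStripFun_suppPow hσ (-1 / 2) (1 / 2)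
  have h2 := isStripFun_suppPow (CFC.abs_nonneg X) p 0
  have h3 := isStripFun_cpow hN (-p) 1
  have h4 := h3.smul (((h1.mul (isStripFun_const (polarPart X))).mul h2).mul h1)
  convert h4 using 1
  funext z
  have e1 : (1 - z) / 2 = ((-1 / 2 : ℝ) : ℂ) * z + ((1 / 2 : ℝ) : ℂ) := by push_cast; ring
  have e2 : z * p = p * z + (0 : ℝ) := by push_cast; ring
  have e3 : 1 - z * p = ((-p : ℝ) : ℂ) * z + (1 : ℝ) := by push_cast; ring
  rw [interpFamily_eq, e3, e1, e2]

theorem lpNorm_top_interpFamily_I_le {σ : H →L[ℂ] H} (hσ : 0 ≤ σ) {Y : H →L[ℂ] H} {p : ℝ}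
    (hN : 0 < lpNorm (ENNReal.ofReal p) σ Y) (t : ℝ) :
    lpNorm ∞ σ (interpFamily σ Y p (Complex.I * t)) ≤ lpNorm (ENNReal.ofReal p) σ Y := by
  set z : ℂ := Complex.I * t with hz
  set X := weighted (ENNReal.ofReal p) σ Y with hX
  set N := lpNorm (ENNReal.ofReal p) σ Y with hNdef
  have hn : ‖(N : ℂ) ^ (1 - z * p)‖ = N := by
    rw [Complex.norm_cpow_eq_rpow_re_of_pos hN]; simp [hz]
  have hD : ‖suppPow σ (-z / 2)‖ ≤ 1 := norm_suppPow_I_le hσ (by simp [hz])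
  have hQ : ‖suppPow (CFC.abs X) (z * p)‖ ≤ 1 :=
    norm_suppPow_I_le (CFC.abs_nonneg X) (by simp [hz])
  have e1 : suppPow σ (-(1 / 2)) * suppPow σ ((1 - z) / 2) = suppPow σ (-z / 2) := by
    rw [suppPow_mul]; ring_nf
  have e2 : suppPow σ ((1 - z) / 2) * suppPow σ (-(1 / 2)) = suppPow σ (-z / 2) := by
    rw [suppPow_mul]; ring_nf
  rw [lpNorm_top, interpFamily_eq, mul_smul_comm, smul_mul_assoc, norm_smul, hn,
    ← mul_assoc, ← mul_assoc, ← mul_assoc, e1, mul_assoc _ _ (suppPow σ (-(1 / 2))), e2]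
  exact mul_le_of_le_one_right hN.le
    (norm_mul_le_one (norm_mul_le_one (norm_mul_le_one hD (norm_polarPart_le X)) hQ) hD)

theorem lpNorm_rpow {σ Y : H →L[ℂ] H} {p : ℝ} (hp : 0 < p) :
    lpNorm (ENNReal.ofReal p) σ Y ^ p
      = (opTrace (suppPow (CFC.abs (weighted (ENNReal.ofReal p) σ Y)) p)).re := by
  rw [lpNorm]
  set X := weighted (ENNReal.ofReal p) σ Y
  rw [← inv_ofReal_inv hp, schattenNorm_inv_ofReal (inv_pos.2 hp), inv_inv, ← Real.rpow_mul
    (opTrace_nonneg (suppPow_nonneg (CFC.abs_nonneg X) p)), inv_mul_cancel₀ hp.ne', Real.rpow_one]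

/-- Apart from contractions the operator is |X|^p, of trace N^p, and the scalar has modulus N^(1-p).
-/
theorem schattenNorm_one_interpFamily_le {σ : H →L[ℂ] H} (hσ : 0 ≤ σ) {Y : H →L[ℂ] H} {p : ℝ}
    (hp : 0 < p) (hN : 0 < lpNorm (ENNReal.ofReal p) σ Y) (t : ℝ) :
    schattenNorm 1 (interpFamily σ Y p (1 + Complex.I * t)) ≤ lpNorm (ENNReal.ofReal p) σ Y := by
  have hpow := lpNorm_rpow (σ := σ) (Y := Y) hp
  set z : ℂ := 1 + Complex.I * t with hz
  set X := weighted (ENNReal.ofReal p) σ Y with hX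
  set N := lpNorm (ENNReal.ofReal p) σ Y with hNdef
  have hn : ‖(N : ℂ) ^ (1 - z * p)‖ = N ^ (1 - p) := by
    rw [Complex.norm_cpow_eq_rpow_re_of_pos hN]; simp [hz]
  have hD : ‖suppPow σ ((1 - z) / 2)‖ ≤ 1 := norm_suppPow_I_le hσ (by simp [hz])
  have hQ : ‖suppPow (CFC.abs X) (Complex.I * t * p)‖ ≤ 1 :=
    norm_suppPow_I_le (CFC.abs_nonneg X) (by simp)
  have e1 : suppPow (CFC.abs X) (z * p)
      = suppPow (CFC.abs X) p * suppPow (CFC.abs X) (Complex.I * t * p) := by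
    rw [suppPow_mul, hz]; ring_nf
  have h1 := schattenNorm_one_mul_mul_le (X := suppPow (CFC.abs X) p)
    (norm_mul_le_one hD (norm_polarPart_le X)) (norm_mul_le_one hQ hD)
  rw [interpFamily_eq, schattenNorm_one_smul, hn, e1]
  rw [schattenNorm_one_of_nonneg (suppPow_nonneg (CFC.abs_nonneg X) p), ← hpow] at h1
  calc _ = N ^ (1 - p) * schattenNorm 1 (suppPow σ ((1 - z) / 2) * polarPart X *
          suppPow (CFC.abs X) p * (suppPow (CFC.abs X) (Complex.I * t * p) *
            suppPow σ ((1 - z) / 2))) := by simp only [hX, mul_assoc]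
    _ ≤ N ^ (1 - p) * N ^ p := by gcongr
    _ = N := by rw [← Real.rpow_add hN]; simp

theorem interpFamily_inv {σ : H →L[ℂ] H} (hσ : 0 ≤ σ) {Y : H →L[ℂ] H} (hY : Y ∈ LSpace σ) {p : ℝ}
    (hp : 0 < p) : interpFamily σ Y p ((p⁻¹ : ℝ) : ℂ) = Y := by
  obtain ⟨h1, h2⟩ := (mem_LSpace_iff hσ).1 hY
  have e : ((p⁻¹ : ℝ) : ℂ) * p = 1 := by
    rw [← Complex.ofReal_mul, inv_mul_cancel₀ hp.ne', Complex.ofReal_one]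
  set X := weighted (ENNReal.ofReal p) σ Y with hX
  have hn : IsStarNormal (CFC.abs X) := (IsSelfAdjoint.of_nonneg (CFC.abs_nonneg X)).isStarNormal
  rw [interpFamily_eq, e, sub_self, Complex.cpow_zero, one_smul, suppPow_one hn,
    mul_assoc (suppPow σ _), polar_mul_abs, ← inv_ofReal_inv hp,
    weighted_inv_ofReal (inv_nonneg.2 hp.le), ← mul_assoc, ← mul_assoc, suppPow_mul,
    mul_assoc _ (suppPow σ _) (suppPow σ _), suppPow_mul, add_neg_cancel, neg_add_cancel, h1, h2]

theorem interpFamily_eq_zero {σ Y : H →L[ℂ] H} {p : ℝ} (hp : 0 < p)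
    (hN : lpNorm (ENNReal.ofReal p) σ Y = 0) (z : ℂ) : interpFamily σ Y p z = 0 := by
  rw [lpNorm, ← inv_ofReal_inv hp] at hN
  have h := eq_zero_of_schattenNorm_eq_zero (inv_pos.2 hp) hN
  rw [inv_ofReal_inv hp] at h
  rw [interpFamily_eq, h, polarPart]
  simp

theorem lpNorm_zero {θ : ℝ} (hθ : 0 < θ) (σ : H →L[ℂ] H) :
    lpNorm (ENNReal.ofReal θ)⁻¹ σ 0 = 0 := by
  have hc : suppPow (0 : H →L[ℂ] H) ((θ⁻¹ : ℝ) : ℂ) = 0 := by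
    have h := suppPow_mul (0 : H →L[ℂ] H) (((θ⁻¹ : ℝ) : ℂ) - 1) 1
    rwa [suppPow_one inferInstance, mul_zero, sub_add_cancel, eq_comm] at h
  rw [lpNorm, weighted, mul_zero, zero_mul, schattenNorm_inv_ofReal hθ, CFC.abs_zero, hc,
    ← opTraceCLM_apply, map_zero, Complex.zero_re, Real.zero_rpow hθ.ne']

/-- A strip function with boundary values bounded by the norm it attains at an interior point. -/
theorem lpNorm_eq_of_boundary_le {σ : H →L[ℂ] H} (hσ : 0 ≤ σ) {h : ℂ → H →L[ℂ] H}
    (hL : ∀ z ∈ strip, h z ∈ LSpace σ) (hh : IsStripFun h) {N : ℝ}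
    (h0 : ∀ t : ℝ, lpNorm ∞ σ (h (Complex.I * t)) ≤ N)
    (h1 : ∀ t : ℝ, schattenNorm 1 (h (1 + Complex.I * t)) ≤ N)
    {θ : ℝ} (hθ : θ ∈ Set.Ioo (0 : ℝ) 1) (heq : lpNorm (ENNReal.ofReal θ)⁻¹ σ (h θ) = N)
    {η : ℝ} (hη : η ∈ Set.Icc (0 : ℝ) 1) : lpNorm (ENNReal.ofReal η)⁻¹ σ (h η) = N := by
  have hle := boundaryMax_le h0 h1
  have hge := lpNorm_le_boundaryMax hσ hL hh (Set.Ioo_subset_Icc_self hθ)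
  have hM : boundaryMax σ h = N := le_antisymm hle (heq ▸ hge)
  rw [← hM]
  exact lpNorm_eq_boundaryMax hσ hL hh hθ (heq.trans hM.symm) hη

theorem lpNorm_map_interpFamily {Φ : (H →L[ℂ] H) →ₗ[ℂ] (K →L[ℂ] K)} (hΦ : IsPositiveMap Φ)
    (hT : IsTracePreserving Φ) {σ Y : H →L[ℂ] H} (hσ : 0 ≤ σ) (hY : Y ∈ LSpace σ) {p : ℝ}
    (hp : 1 < p) (heq : lpNorm (ENNReal.ofReal p) (Φ σ) (Φ Y) = lpNorm (ENNReal.ofReal p) σ Y)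
    {θ : ℝ} (hθ : θ ∈ Set.Ioo (0 : ℝ) 1) :
    lpNorm (ENNReal.ofReal θ)⁻¹ (Φ σ) (Φ (interpFamily σ Y p θ))
      = lpNorm (ENNReal.ofReal θ)⁻¹ σ (interpFamily σ Y p θ) := by
  have hp0 : 0 < p := zero_lt_one.trans hp
  -- If the norm N of Y is 0, the family vanishes identically; N > 0 is needed for N^(1 - zp) to be
  -- holomorphic in z.
  rcases (lpNorm_nonneg (ENNReal.ofReal p) σ Y).eq_or_lt with hN | hN
  · rw [interpFamily_eq_zero hp0 hN.symm, map_zero, lpNorm_zero hθ.1, lpNorm_zero hθ.1]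
  have hpθ : p⁻¹ ∈ Set.Ioo (0 : ℝ) 1 := ⟨inv_pos.2 hp0, inv_lt_one_of_one_lt₀ hp⟩
  have hθ' := Set.Ioo_subset_Icc_self hθ
  have hL := interpFamily_mem_LSpace hσ Y p
  have hf := isStripFun_interpFamily hσ hN
  have hf0 := lpNorm_top_interpFamily_I_le hσ hN
  have hf1 := schattenNorm_one_interpFamily_le hσ hp0 hN
  rw [lpNorm_eq_of_boundary_le hσ (fun z _ => hL z) hf hf0 hf1 hpθ
    (by rw [inv_ofReal_inv hp0, interpFamily_inv hσ hY hp0]) hθ']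
  -- The endpoint contractions bound Φ ∘ f on the boundary by N, and the hypothesis says that N is
  -- attained at 1/p.
  exact lpNorm_eq_of_boundary_le (h := fun z => Φ (interpFamily σ Y p z)) (hΦ.map_nonneg hσ)
    (fun z _ => map_mem_LSpace hΦ hσ (hL z)) (hf.clm (LinearMap.toContinuousLinearMap Φ))
    (fun t => (lpNorm_top_map_le hΦ hσ (hL _)).trans (hf0 t))
    (fun t => (schattenNorm_one_map_le hΦ hT _).trans (hf1 t)) hpθ
    (by rw [inv_ofReal_inv hp0, interpFamily_inv hσ hY hp0, heq]) hθ'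

end StateLp

end

theorem mainTheorem3
    {H : Type*} [NormedAddCommGroup H] [InnerProductSpace ℂ H] [CompleteSpace H]
    [FiniteDimensional ℂ H]
    {K : Type*} [NormedAddCommGroup K] [InnerProductSpace ℂ K] [CompleteSpace K]
    [FiniteDimensional ℂ K]
    (σ : H →L[ℂ] H) (hσ : IsState σ) :
    (∀ h : ℂ → H →L[ℂ] H, (∀ z ∈ strip, h z ∈ LSpace σ) →
      (∃ C : ℝ, ∀ z ∈ strip, ‖h z‖ ≤ C) → ContinuousOn h strip →
      DifferentiableOn ℂ h (interior strip) →
      (∀ θ ∈ Set.Icc (0 : ℝ) 1, lpNorm (ENNReal.ofReal θ)⁻¹ σ (h θ) ≤ boundaryMax σ h) ∧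
      ((∃ θ ∈ Set.Ioo (0 : ℝ) 1, lpNorm (ENNReal.ofReal θ)⁻¹ σ (h θ) = boundaryMax σ h) →
        ∀ θ ∈ Set.Icc (0 : ℝ) 1, lpNorm (ENNReal.ofReal θ)⁻¹ σ (h θ) = boundaryMax σ h)) ∧
    (∀ Φ : (H →L[ℂ] H) →ₗ[ℂ] (K →L[ℂ] K), IsPositiveMap Φ → IsTracePreserving Φ →
      ∀ p : ℝ, 1 < p → ∀ Y ∈ LSpace σ,
        lpNorm (ENNReal.ofReal p) (Φ σ) (Φ Y) = lpNorm (ENNReal.ofReal p) σ Y →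
        ∀ θ ∈ Set.Ioo (0 : ℝ) 1,
          lpNorm (ENNReal.ofReal θ)⁻¹ (Φ σ) (Φ (interpFamily σ Y p θ)) =
            lpNorm (ENNReal.ofReal θ)⁻¹ σ (interpFamily σ Y p θ)) := by
  have h0 : 0 ≤ σ := (ContinuousLinearMap.nonneg_iff_isPositive σ).2 hσ.1
  refine ⟨fun h hL hb hc hd => ⟨fun θ hθ => lpNorm_le_boundaryMax h0 hL ⟨hb, hc, hd⟩ hθ, ?_⟩,
    fun Φ hΦ hT p hp Y hY heq θ hθ => lpNorm_map_interpFamily hΦ hT h0 hY hp heq hθ⟩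
  rintro ⟨θ, hθ, heq⟩ η hη
  exact lpNorm_eq_boundaryMax h0 hL ⟨hb, hc, hd⟩ hθ heq hη
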